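/- For $\nu>0$ let $\gamma(\nu)$ be the gamma distribution with shape $\nu$ and rate $1$, and let $\gamma_\pm(\nu)$ be the law of $\pm(X-\nu)/\sqrt{\nu}$ with $X\sim\gamma(\nu)$. Let $Y_1,\dots,Y_N$ be independent random variables, where for each $i$ the law of $Y_i$ is $\mathcal N(0,1)$, $\gamma_+(\nu_i)$ or $\gamma_-(\nu_i)$ for some $\nu_i>0$. They are realized on the product space $(\Omega,P)=\prod_{i=1}^N(\Omega_i,P_i)$: if $Y_i\sim\mathcal N(0,1)$, then $(\Omega_i,P_i)=(\mathbb R,\mathcal N(0,1))$ and $Y_i(\omega)=\omega_i$; if $Y_i\sim\gamma_\pm(\nu_i)$, then $(\Omega_i,P_i)=((0,\infty),\gamma(\nu_i))$ and $Y_i(\omega)=\pm(\omega_i-\nu_i)/\sqrt{\nu_i}$. Put $v_i=2$ if $Y_i\sim\mathcal N(0,1)$, $v_i=2(1+\nu_i^{-1})$ if $Y_i\sim\gamma_\pm(\nu_i)$, and $\overline v_N=\max_{1\le i\le N}v_i$. Let $\mathcal L_i$ be the operator acting on the $i$-th coordinate by $\mathcal L_i\phi(x)=\phi''(x)-x\phi'(x)$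 if $Y_i\sim\mathcal N(0,1)$ and $\mathcal L_i\phi(x)=x\phi''(x)+(\nu_i-x)\phi'(x)$ if $Y_i\sim\gamma_\pm(\nu_i)$. On smooth functions on $\Omega$ all of whose partial derivatives have at most polynomial growth, put $\mathrm L=\sum_{i=1}^N\mathcal L_i$ and $$\Gamma(F,G)=\tfrac12\bigl(\mathrm L(FG)-F\,\mathrm LG-G\,\mathrm LF\bigr).$$ For a positive integer $p$ and a function $f:\{1,\dots,N\}^p\to\mathbb R$, put $$Q(f;Y)=\sum_{i_1,\dots,i_p=1}^N f(i_1,\dots,i_p)Y_{i_1}\cdots Y_{i_p},\qquad \mathrm{Inf}_i(f)=\sum_{i_2,\dots,i_p=1}^N f(i,i_2,\dots,i_p)^2,\qquad \mathfrak c_p=\sum_{r=1}^p r!\binom pr^2,$$ and say that $f$ vanishes on diagonals if $f(i_1,\dots,i_p)=0$ unless $i_1,\dots,i_p$ are mutually different. Let $\kappa_4(X)$ denote the fourth cumulant of $X$; thus $\kappa_4(X)=E[(X-E[X])^4]-3\,\mathrm{Var}[X]^2$. Let $p\le q$ be positive integers, let $f:\{1,\dots,N\}^p\to\mathbb R$ and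 $g:\{1,\dots,N\}^q\to\mathbb R$ be symmetric functions vanishing on diagonals, and set $F=Q(f;Y)$, $G=Q(g;Y)$. Then $E[F^4]$, $E[G^4]$ and $E[\Gamma(F,G)^2]$ are finite, $\kappa_4(F)\ge0$, $\kappa_4(G)\ge0$, and $$\mathrm{Var}\Bigl[\frac1q\Gamma(F,G)\Bigr]\le 1_{\{p<q\}}\sqrt{E[F^4]}\sqrt{\kappa_4(G)}+1_{\{p=q\}}\Bigl\{2\sqrt{\kappa_4(F)}\sqrt{\kappa_4(G)}+\bigl(2^{-p}\,\overline v_N^{\,p}-1\bigr)(2p)!\,\mathfrak c_p\sqrt{\sum_{i=1}^N\mathrm{Inf}_i(f)^2}\sqrt{\sum_{i=1}^N\mathrm{Inf}_i(g)^2}\Bigr\}.$$ -/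

import Mathlib

open MeasureTheory ProbabilityTheory

noncomputable section

namespace NormalGamma

/-- The admissible laws of a single variable: `normal` is `N(0,1)`; `gammaPlus ν` (resp.
`gammaMinus ν`) is the law of `(X - ν) / √ν` (resp. `-(X - ν) / √ν`), where `X` has the gamma
distribution with shape `ν` and rate `1`. -/
inductive Law where
  | normal : Law
  | gammaPlus (ν : ℝ) (hν : 0 < ν) : Law
  | gammaMinus (ν : ℝ) (hν : 0 < ν) : Law

namespace Law

/-- The probability measure on the `i`-th coordinate of the canonical space: `N(0,1)`, or the gamma
distribution with shape `ν` and rate `1` (a measure on `ℝ` concentrated on `(0, ∞)`). -/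
def base : Law → Measure ℝ
  | normal => gaussianReal 0 1
  | gammaPlus ν _ => gammaMeasure ν 1
  | gammaMinus ν _ => gammaMeasure ν 1

/-- The realization of the variable as a function of the coordinate. -/
def toVar : Law → ℝ → ℝ
  | normal, x => x
  | gammaPlus ν _, x => (x - ν) / √ν
  | gammaMinus ν _, x => -((x - ν) / √ν)

/-- The one-dimensional generator: the Ornstein–Uhlenbeck operator `φ'' - x φ'` for the normal law,
and the Laguerre operator `x φ'' + (ν - x) φ'` for the gamma laws. -/
def generator : Law → (ℝ → ℝ) → ℝ → ℝ
  | normal, φ, x => deriv (deriv φ) x - x * deriv φ x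
  | gammaPlus ν _, φ, x => x * deriv (deriv φ) x + (ν - x) * deriv φ x
  | gammaMinus ν _, φ, x => x * deriv (deriv φ) x + (ν - x) * deriv φ x

/-- The constant `v`: `2` for the normal law, `2 (1 + 1/ν)` for the gamma laws. -/
def v : Law → ℝ
  | normal => 2
  | gammaPlus ν _ => 2 * (1 + ν⁻¹)
  | gammaMinus ν _ => 2 * (1 + ν⁻¹)

instance (l : Law) : IsProbabilityMeasure l.base := by
  cases l with
  | normal => exact inferInstanceAs (IsProbabilityMeasure (gaussianReal 0 1))
  | gammaPlus ν hν => exact isProbabilityMeasure_gammaMeasure hν one_pos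
  | gammaMinus ν hν => exact isProbabilityMeasure_gammaMeasure hν one_pos

end Law

variable {N p q : ℕ}

/-- The product probability measure on the canonical space. -/
def prob (l : Fin N → Law) : Measure (Fin N → ℝ) :=
  Measure.pi fun i => (l i).base

/-- The variables `Y = (Y_1, …, Y_N)` on the canonical space; they are independent and `Y_i` has the
law described by `l i`. -/
def Y (l : Fin N → Law) (i : Fin N) (ω : Fin N → ℝ) : ℝ :=
  (l i).toVar (ω i)

/-- The tensorization `L = ∑ i, 𝓛_i` of the one-dimensional generators, where `𝓛_i` acts on the
`i`-th coordinate. It is used on smooth functions only. -/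
def L (l : Fin N → Law) (F : (Fin N → ℝ) → ℝ) (ω : Fin N → ℝ) : ℝ :=
  ∑ i, (l i).generator (fun t => F (Function.update ω i t)) (ω i)

/-- The carré du champ operator of `L`. -/
def carreDuChamp (l : Fin N → Law) (F G : (Fin N → ℝ) → ℝ) (ω : Fin N → ℝ) : ℝ :=
  (1 / 2) * (L l (fun ω' => F ω' * G ω') ω - F ω * L l G ω - G ω * L l F ω)

/-- `f : [N]^p → ℝ` is symmetric. -/
def IsSymm (f : (Fin p → Fin N) → ℝ) : Prop :=
  ∀ (σ : Equiv.Perm (Fin p)) (i : Fin p → Fin N), f (fun k => i (σ k)) = f i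

/-- `f(i_1, …, i_p) = 0` unless `i_1, …, i_p` are mutually different. -/
def VanishesOnDiagonals (f : (Fin p → Fin N) → ℝ) : Prop :=
  ∀ i : Fin p → Fin N, ¬ Function.Injective i → f i = 0

/-- The homogeneous sum `∑ f(i_1, …, i_p) y_{i_1} ⋯ y_{i_p}`. -/
def homSum (f : (Fin p → Fin N) → ℝ) (y : Fin N → ℝ) : ℝ :=
  ∑ i : Fin p → Fin N, f i * ∏ k, y (i k)

/-- The homogeneous sum `Q(f; Y)` as a random variable on the canonical space. -/
def Q (l : Fin N → Law) (f : (Fin p → Fin N) → ℝ) (ω : Fin N → ℝ) : ℝ :=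
  homSum f (fun i => Y l i ω)

/-- The influence of the `i`-th variable: the sum of `f(i, i_2, …, i_p)^2` over `i_2, …, i_p`. -/
def influence [NeZero p] (f : (Fin p → Fin N) → ℝ) (i : Fin N) : ℝ :=
  ∑ j : Fin p → Fin N with j 0 = i, f j ^ 2

/-- The fourth cumulant, expressed through central moments. -/
def kappa4 {Ω : Type*} [MeasurableSpace Ω] (X : Ω → ℝ) (P : Measure Ω) : ℝ :=
  centralMoment X 4 P - 3 * centralMoment X 2 P ^ 2

/-- The constant `𝔠_q = ∑_{r=1}^q r! (q choose r)^2`. -/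
def c (q : ℕ) : ℕ :=
  ∑ r ∈ Finset.Icc 1 q, r.factorial * q.choose r ^ 2

/-- The maximum `max_i v_i`. -/
def vMax (l : Fin N → Law) : ℝ :=
  ⨆ i, (l i).v

end NormalGamma

end

/-! ### Moments of the normal and gamma laws -/

/-! In each coordinate the polynomials `1`, `Y`, `Y² - sY - 1`, with `s = E[Y³]`, are orthogonal
with squared norms `1, 1, v`, and they are eigenfunctions of the generator with eigenvalues `0, -1,
-2`. Their tensor products, indexed by `α : Fin N → Fin 3`, are orthogonal with squared norms `w_α`
and satisfy `L = -|α|`. A kernel vanishing on diagonals gives a multilinear polynomial, so `F²`,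
`G²` and `FG` all expand in this finite system.

On the `α`-component of `FG`, the operator `Γ` acts as the factor `(p + q - |α|)/2`. For `p ≤ q`,
division by `q` leaves factors of modulus at most `1`, with `0` at the top degree `p + q`. Hence
`Var[Γ(F,G)/q] ≤ E[F²G²] - E[FG]² - ‖top(FG)‖²` (`variance_carreDuChamp_le`), where `E[F²G²]` is
read as the inner product of `F²` and `G²`.

Top-degree coefficients do not depend on the laws. Since `w_α` dominates its normal value `w⁰_α`
(each `v` replaced by `2`), lower bounds for top parts reduce to the normal case. There,
`sum_normalWeight_mul_topCoeff` turns inner products of top parts into inner products of contraction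
matrices, and isolated entries of these give the bounds: - `‖top(F²)‖² ≥ 2 E[F²]²`, so the
components of `F²` of intermediate degree have squared norm at most `κ₄(F)`; in particular `κ₄(F) ≥
0`. - `‖top(FG)‖² ≥ E[F²]E[G²]`, which absorbs the constant term of `E[F²G²]`. If `p < q`, then `F²`
has no component of degree `2q`, and Cauchy–Schwarz concludes. - If `p = q`, the top parts of `F²`
and `G²` also meet. With the weights `w⁰` their inner product is absorbed by antisymmetrizing the
contraction matrix (`topCoeff_cross_le`). The excess `w - w⁰` lives on the `α` taking the value `2`,
that is, on pairs of overlapping monomials, and is controlled by influences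
(`sum_weight_excess_le`). -/

theorem integrable_pow_gaussianReal (k : ℕ) :
    Integrable (fun x : ℝ => x ^ k) (gaussianReal 0 1) := by
  have h := memLp_id_gaussianReal (μ := 0) (v := 1) (k : NNReal)
  simpa using h.integrable_norm_pow' |>.mono' (by fun_prop) (by simp)

theorem integral_pow_gaussianReal :
    ∫ x, x ∂(gaussianReal 0 1) = 0 ∧ ∫ x, x ^ 2 ∂(gaussianReal 0 1) = 1 ∧
    ∫ x, x ^ 3 ∂(gaussianReal 0 1) = 0 ∧ ∫ x, x ^ 4 ∂(gaussianReal 0 1) = 3 := by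
  have hm (k : ℕ) : ∫ x, x ^ k ∂(gaussianReal 0 1)
      = iteratedDeriv k (fun t : ℝ => Real.exp (t ^ 2 / 2)) 0 := by
    have h := iteratedDeriv_mgf_zero (X := (id : ℝ → ℝ)) (μ := gaussianReal 0 1) (by simp) k
    rw [mgf_id_gaussianReal] at h
    simpa using h.symm
  -- Differentiating `P(t) exp(t²/2)` replaces `P` by `P' + tP`. The polynomials below stay
  -- unsimplified so that each input matches the preceding output literally.
  have hd (P P' : ℝ → ℝ) (hP : ∀ t, HasDerivAt P (P' t) t) :
      deriv (fun t : ℝ => P t * Real.exp (t ^ 2 / 2))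
        = fun t => (P' t + t * P t) * Real.exp (t ^ 2 / 2) := by
    funext t
    have h2 : HasDerivAt (fun t : ℝ => t ^ 2 / 2) t t := by
      simpa using (hasDerivAt_pow 2 t).div_const 2
    exact (((hP t).mul h2.exp).congr_deriv (by ring)).deriv
  have d0 : (fun t : ℝ => Real.exp (t ^ 2 / 2)) = fun t => 1 * Real.exp (t ^ 2 / 2) := by simp
  have e1 := hd (fun _ => 1) (fun _ => 0) (fun t => hasDerivAt_const t _)
  have e2 := hd (fun t => 0 + t * 1) (fun _ => 1) (fun t => by simpa using hasDerivAt_id' t)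
  have e3 := hd (fun t => 1 + t * (0 + t * 1)) (fun t => 2 * t) (fun t => by
    simpa [← pow_two] using (hasDerivAt_pow 2 t).const_add 1)
  have e4 := hd (fun t => 2 * t + t * (1 + t * (0 + t * 1))) (fun t => 3 + 3 * t ^ 2) (fun t => by
    have := ((hasDerivAt_id t).const_mul 3).add (hasDerivAt_pow 3 t)
    refine (this.congr_deriv (by simp)).congr_of_eventuallyEq (.of_forall fun x => ?_)
    simp; ring)
  have h1 := hm 1
  simp only [pow_one] at h1
  refine ⟨?_, ?_, ?_, ?_⟩
  · rw [h1, d0, iteratedDeriv_one, e1]; simp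
  · rw [hm, d0]; simp only [iteratedDeriv_succ, iteratedDeriv_zero]; rw [e1, e2]; simp
  · rw [hm, d0]; simp only [iteratedDeriv_succ, iteratedDeriv_zero]; rw [e1, e2, e3]; simp
  · rw [hm, d0]; simp only [iteratedDeriv_succ, iteratedDeriv_zero]; rw [e1, e2, e3, e4]; simp

theorem integral_gammaMeasure {ν : ℝ} (hν : 0 < ν) (g : ℝ → ℝ) :
    ∫ x, g x ∂(gammaMeasure ν 1) =
      (Real.Gamma ν)⁻¹ * ∫ x in Set.Ioi 0, x ^ (ν - 1) * Real.exp (-x) * g x := by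
  rw [gammaMeasure]
  unfold gammaPDF
  rw [integral_withDensity_eq_integral_toReal_smul (by fun_prop) (by simp)]
  rw [← integral_indicator measurableSet_Ioi, ← integral_const_mul]
  apply integral_congr_ae
  -- The gamma density is supported on `0 ≤ x`, the set integral on `0 < x`; the null set `{0}` is
  -- discarded.
  have : ∀ᵐ x : ℝ, x ≠ 0 := by simp [ae_iff]
  filter_upwards [this] with x hx
  rw [ENNReal.toReal_ofReal (gammaPDFReal_nonneg hν one_pos x)]
  by_cases h : 0 < x
  · simp [gammaPDFReal, h.le, h]; ring
  · have : ¬ 0 ≤ x := fun h' => h (lt_of_le_of_ne h' hx.symm)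
    simp [gammaPDFReal, this, h]

theorem integrable_gammaMeasure {ν : ℝ} (hν : 0 < ν) {g : ℝ → ℝ}
    (h : IntegrableOn (fun x => x ^ (ν - 1) * Real.exp (-x) * g x) (Set.Ioi 0)) :
    Integrable g (gammaMeasure ν 1) := by
  rw [gammaMeasure]
  unfold gammaPDF
  rw [integrable_withDensity_iff_integrable_smul' (by fun_prop) (by simp)]
  rw [← integrable_indicator_iff measurableSet_Ioi] at h
  refine (h.const_mul (Real.Gamma ν)⁻¹).congr ?_
  have : ∀ᵐ x : ℝ, x ≠ 0 := by simp [ae_iff]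
  filter_upwards [this] with x hx
  rw [ENNReal.toReal_ofReal (gammaPDFReal_nonneg hν one_pos x)]
  by_cases h : 0 < x
  · simp [gammaPDFReal, h.le, h]; ring
  · have : ¬ 0 ≤ x := fun h' => h (lt_of_le_of_ne h' hx.symm)
    simp [gammaPDFReal, this, h]

theorem rpow_mul_exp_mul_pow_eqOn (ν : ℝ) (k : ℕ) :
    Set.EqOn (fun x : ℝ => x ^ (ν - 1) * Real.exp (-x) * x ^ k)
      (fun x => Real.exp (-x) * x ^ (ν + k - 1)) (Set.Ioi 0) := by
  intro x hx
  have : ν + k - 1 = ν - 1 + k := by ring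
  simp only [this, Real.rpow_add_natCast (ne_of_gt hx)]
  ring

theorem integrable_pow_gammaMeasure {ν : ℝ} (hν : 0 < ν) (k : ℕ) :
    Integrable (fun x : ℝ => x ^ k) (gammaMeasure ν 1) := by
  apply integrable_gammaMeasure hν
  rw [integrableOn_congr_fun (rpow_mul_exp_mul_pow_eqOn ν k) measurableSet_Ioi]
  exact Real.GammaIntegral_convergent (by positivity)

theorem integral_pow_gammaMeasure {ν : ℝ} (hν : 0 < ν) (k : ℕ) :
    ∫ x, x ^ k ∂(gammaMeasure ν 1) = (Real.Gamma ν)⁻¹ * Real.Gamma (ν + k) := by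
  rw [integral_gammaMeasure hν, setIntegral_congr_fun measurableSet_Ioi
    (rpow_mul_exp_mul_pow_eqOn ν k), Real.Gamma_eq_integral (s := ν + k) (by positivity)]

theorem integral_pow_succ_gammaMeasure {ν : ℝ} (hν : 0 < ν) (k : ℕ) :
    ∫ x, x ^ (k + 1) ∂(gammaMeasure ν 1) = (ν + k) * ∫ x, x ^ k ∂(gammaMeasure ν 1) := by
  rw [integral_pow_gammaMeasure hν, integral_pow_gammaMeasure hν]
  have : ν + ((k + 1 : ℕ) : ℝ) = ν + k + 1 := by push_cast; ring
  rw [this, Real.Gamma_add_one (by positivity)]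
  ring

/-- The integral of a quartic polynomial in terms of the moments. -/
theorem integral_quartic {μ : Measure ℝ} [IsProbabilityMeasure μ] {g : ℝ → ℝ}
    (hi : ∀ k : ℕ, Integrable (fun x => g x ^ k) μ) (a b c d e : ℝ) :
    Integrable (fun x => a + b * g x + c * g x ^ 2 + d * g x ^ 3 + e * g x ^ 4) μ ∧
    ∫ x, (a + b * g x + c * g x ^ 2 + d * g x ^ 3 + e * g x ^ 4) ∂μ =
      a + b * ∫ x, g x ∂μ + c * ∫ x, g x ^ 2 ∂μ + d * ∫ x, g x ^ 3 ∂μ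
        + e * ∫ x, g x ^ 4 ∂μ := by
  have h0 : Integrable (fun _ : ℝ => a) μ := integrable_const a
  have h1 : Integrable (fun x => b * g x) μ := by simpa using (hi 1).const_mul b
  have h2 := (hi 2).const_mul c
  have h3 := (hi 3).const_mul d
  have h4 := (hi 4).const_mul e
  have h01 : Integrable (fun x => a + b * g x) μ := h0.add h1
  have h02 : Integrable (fun x => a + b * g x + c * g x ^ 2) μ := h01.add h2
  have h03 : Integrable (fun x => a + b * g x + c * g x ^ 2 + d * g x ^ 3) μ := h02.add h3
  refine ⟨h03.add h4, ?_⟩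
  rw [integral_add h03 h4, integral_add h02 h3, integral_add h01 h2, integral_add h0 h1]
  simp [integral_const_mul]

namespace NormalGamma.Law

/-- The third moment of the variable. -/
noncomputable def skew : Law → ℝ
  | normal => 0
  | gammaPlus ν _ => 2 / √ν
  | gammaMinus ν _ => -(2 / √ν)

/-- The scale `c` stands for `±1/√ν`, so one computation serves both gamma laws. -/
theorem gamma_central_moments {ν c : ℝ} (hν : 0 < ν) (hc : c ^ 2 * ν = 1) :
    (∀ k : ℕ, Integrable (fun x => (c * (x - ν)) ^ k) (gammaMeasure ν 1)) ∧
    ∫ x, c * (x - ν) ∂(gammaMeasure ν 1) = 0 ∧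
    ∫ x, (c * (x - ν)) ^ 2 ∂(gammaMeasure ν 1) = 1 ∧
    ∫ x, (c * (x - ν)) ^ 3 ∂(gammaMeasure ν 1) = 2 * c ∧
    ∫ x, (c * (x - ν)) ^ 4 ∂(gammaMeasure ν 1) = 3 + 6 * c ^ 2 := by
  have := isProbabilityMeasure_gammaMeasure hν one_pos
  have q := fun a b c d e => (integral_quartic (g := fun x => x)
    (integrable_pow_gammaMeasure hν) a b c d e).2
  have m0 : ∫ x : ℝ, x ^ 0 ∂(gammaMeasure ν 1) = 1 := by simp
  have m1 := integral_pow_succ_gammaMeasure hν 0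
  have m2 := integral_pow_succ_gammaMeasure hν 1
  have m3 := integral_pow_succ_gammaMeasure hν 2
  have m4 := integral_pow_succ_gammaMeasure hν 3
  norm_num at m1 m2 m3 m4
  rw [m1] at m2; rw [m2] at m3; rw [m3] at m4
  rw [m4, m3, m2, m1] at q
  refine ⟨fun k => ?_, ?_, ?_, ?_, ?_⟩
  · simp_rw [mul_pow]
    refine Integrable.const_mul ?_ _
    simp_rw [sub_eq_add_neg, add_pow]
    refine integrable_finsetSum _ fun m _ => ?_
    exact ((integrable_pow_gammaMeasure hν m).mul_const _).mul_const _
  · convert q (-(c * ν)) c 0 0 0 using 1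
    · congr 1; ext x; ring
    · ring
  · convert q (c ^ 2 * ν ^ 2) (-2 * c ^ 2 * ν) (c ^ 2) 0 0 using 1
    · congr 1; ext x; ring
    · linear_combination -hc
  · convert q (-c ^ 3 * ν ^ 3) (3 * c ^ 3 * ν ^ 2) (-3 * c ^ 3 * ν) (c ^ 3) 0 using 1
    · congr 1; ext x; ring
    · linear_combination -2 * c * hc
  · convert q (c ^ 4 * ν ^ 4) (-4 * c ^ 4 * ν ^ 3) (6 * c ^ 4 * ν ^ 2) (-4 * c ^ 4 * ν) (c ^ 4)
      using 1
    · congr 1; ext x; ring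
    · linear_combination (-3 * c ^ 2 * ν - 3 - 6 * c ^ 2) * hc

/-- The fourth moment is put in this form because `E[(Y² - sY - 1)²] = E[Y⁴] - s² - 1`; thus `v` is
exactly the squared norm of the quadratic polynomial. -/
theorem moments_toVar (l : Law) :
    (∀ k : ℕ, Integrable (fun x => l.toVar x ^ k) l.base) ∧
    ∫ x, l.toVar x ∂l.base = 0 ∧ ∫ x, l.toVar x ^ 2 ∂l.base = 1 ∧
    ∫ x, l.toVar x ^ 3 ∂l.base = l.skew ∧
    ∫ x, l.toVar x ^ 4 ∂l.base = 1 + l.skew ^ 2 + l.v := by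
  cases l with
  | normal =>
    obtain ⟨h1, h2, h3, h4⟩ := integral_pow_gaussianReal
    refine ⟨integrable_pow_gaussianReal, h1, h2, h3, h4.trans ?_⟩
    norm_num [skew, v]
  | gammaPlus ν hν =>
    have hs := Real.sq_sqrt hν.le
    have hs0 := Real.sqrt_pos.2 hν
    have hc : ((√ν)⁻¹) ^ 2 * ν = 1 := by rw [inv_pow, hs]; field_simp
    have := gamma_central_moments hν hc
    simp only [toVar, skew, v, base]
    have e (x : ℝ) : (x - ν) / √ν = (√ν)⁻¹ * (x - ν) := by ring
    simp_rw [e]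
    refine ⟨this.1, this.2.1, this.2.2.1, this.2.2.2.1, this.2.2.2.2.trans ?_⟩
    rw [inv_pow, div_pow, hs]; ring
  | gammaMinus ν hν =>
    have hs := Real.sq_sqrt hν.le
    have hs0 := Real.sqrt_pos.2 hν
    have hc : (-(√ν)⁻¹) ^ 2 * ν = 1 := by rw [neg_sq, inv_pow, hs]; field_simp
    have := gamma_central_moments hν hc
    simp only [toVar, skew, v, base]
    have e (x : ℝ) : -((x - ν) / √ν) = -(√ν)⁻¹ * (x - ν) := by ring
    simp_rw [e]
    refine ⟨this.1, this.2.1, this.2.2.1, this.2.2.2.1.trans (by ring), this.2.2.2.2.trans ?_⟩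
    rw [neg_sq, neg_sq, inv_pow, div_pow, hs]; ring

/-! ### The orthogonal polynomials of degree at most two -/

/-- The monic orthogonal polynomials of degree `0`, `1`, `2` in the variable. -/
noncomputable def ortho (l : Law) (k : Fin 3) (x : ℝ) : ℝ :=
  ![1, l.toVar x, l.toVar x ^ 2 - l.skew * l.toVar x - 1] k

/-- The squared norms of the polynomials `ortho`. -/
noncomputable def weight (l : Law) (k : Fin 3) : ℝ := ![1, 1, l.v] k

theorem integral_ortho_mul_ortho (l : Law) (a b : Fin 3) :
    Integrable (fun x => l.ortho a x * l.ortho b x) l.base ∧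
    ∫ x, l.ortho a x * l.ortho b x ∂l.base = if a = b then l.weight a else 0 := by
  obtain ⟨hi, h1, h2, h3, h4⟩ := l.moments_toVar
  have q := fun a b c d e => integral_quartic hi a b c d e
  rw [h1, h2, h3, h4] at q
  have key (c0 c1 c2 c3 c4 : ℝ)
      (hf : ∀ x, l.ortho a x * l.ortho b x = c0 + c1 * l.toVar x + c2 * l.toVar x ^ 2
        + c3 * l.toVar x ^ 3 + c4 * l.toVar x ^ 4)
      (hr : c0 + c1 * 0 + c2 * 1 + c3 * l.skew + c4 * (1 + l.skew ^ 2 + l.v)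
        = if a = b then l.weight a else 0) :
      Integrable (fun x => l.ortho a x * l.ortho b x) l.base ∧
      ∫ x, l.ortho a x * l.ortho b x ∂l.base = if a = b then l.weight a else 0 := by
    simp_rw [hf]
    exact ⟨(q c0 c1 c2 c3 c4).1, (q c0 c1 c2 c3 c4).2.trans hr⟩
  set s := l.skew with hs
  fin_cases a <;> fin_cases b
  · exact key 1 0 0 0 0 (fun x => by simp [ortho]) (by simp [weight])
  · exact key 0 1 0 0 0 (fun x => by simp [ortho]) (by simp)
  · exact key (-1) (-s) 1 0 0 (fun x => by simp [ortho]; ring) (by simp)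
  · exact key 0 1 0 0 0 (fun x => by simp [ortho]) (by simp)
  · exact key 0 0 1 0 0 (fun x => by simp [ortho]; ring) (by simp [weight])
  · exact key 0 (-1) (-s) 1 0 (fun x => by simp [ortho]; ring) (by simp)
  · exact key (-1) (-s) 1 0 0 (fun x => by simp [ortho]; ring) (by simp)
  · exact key 0 (-1) (-s) 1 0 (fun x => by simp [ortho]; ring) (by simp)
  · exact key 1 (2 * s) (s ^ 2 - 2) (-2 * s) 1 (fun x => by simp [ortho]; ring)
      (by simp [weight]; ring)

theorem two_le_v (l : Law) : 2 ≤ l.v := by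
  cases l with
  | normal => exact le_rfl
  | gammaPlus ν hν => have := inv_pos.2 hν; simp only [v]; linarith
  | gammaMinus ν hν => have := inv_pos.2 hν; simp only [v]; linarith

theorem contDiff_ortho (l : Law) (k : Fin 3) : ContDiff ℝ 2 (l.ortho k) := by
  have h : ContDiff ℝ 2 l.toVar := by
    cases l <;> (unfold toVar; fun_prop)
  fin_cases k
  · exact contDiff_const
  · exact h
  · exact ((h.pow 2).sub (contDiff_const.mul h)).sub contDiff_const

theorem generator_const_mul (l : Law) (c : ℝ) (φ : ℝ → ℝ) (x : ℝ) :
    l.generator (fun t => c * φ t) x = c * l.generator φ x := by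
  have h1 : deriv (fun t => c * φ t) = fun t => c * deriv φ t := by
    funext t; exact deriv_const_mul_field c
  cases l <;> simp only [generator, h1, deriv_const_mul_field] <;> ring

theorem generator_sum (l : Law) {ι : Type*} (s : Finset ι) (φ : ι → ℝ → ℝ)
    (h : ∀ i ∈ s, ContDiff ℝ 2 (φ i)) (x : ℝ) :
    l.generator (fun t => ∑ i ∈ s, φ i t) x = ∑ i ∈ s, l.generator (φ i) x := by
  have h1 : deriv (fun t => ∑ i ∈ s, φ i t) = fun t => ∑ i ∈ s, deriv (φ i) t := by
    funext t
    exact deriv_fun_sum fun i hi => ((h i hi).differentiable two_ne_zero).differentiableAt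
  have h2 : deriv (fun t => ∑ i ∈ s, deriv (φ i) t) x = ∑ i ∈ s, deriv (deriv (φ i)) x :=
    deriv_fun_sum fun i hi =>
      ((contDiff_succ_iff_deriv (n := 1).1 (h i hi)).2.2.differentiable one_ne_zero).differentiableAt
  cases l <;> simp only [generator, h1, h2, Finset.mul_sum, ← Finset.sum_add_distrib,
    ← Finset.sum_sub_distrib]

theorem deriv_ortho (l : Law) {c d : ℝ} (h : ∀ x, l.toVar x = c * x + d) :
    deriv (l.ortho 0) = (fun _ => 0) ∧ deriv (l.ortho 1) = (fun _ => c) ∧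
    deriv (l.ortho 2) = (fun x => 2 * c * l.toVar x - l.skew * c) ∧
    deriv l.toVar = fun _ => c := by
  have hd (x : ℝ) : HasDerivAt l.toVar c x := by
    have : l.toVar = fun x => c * x + d := funext h
    rw [this]
    simpa using ((hasDerivAt_id x).const_mul c).add_const d
  refine ⟨?_, funext fun x => (hd x).deriv, funext fun x => ?_, funext fun x => (hd x).deriv⟩
  · exact funext fun x => (hasDerivAt_const x (1 : ℝ)).deriv
  · have := ((((hd x).pow 2).sub ((hd x).const_mul l.skew)).sub (hasDerivAt_const x 1))
    exact (this.congr_deriv (by simp; ring)).deriv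

/-- These are Hermite and rescaled Laguerre polynomials. In the gamma cases `Y = c(x - ν)` with `c²ν
= 1` and third moment `2c`, and these two relations are all that is needed. -/
theorem generator_ortho (l : Law) (k : Fin 3) (x : ℝ) :
    l.generator (l.ortho k) x = -(k : ℕ) * l.ortho k x := by
  have h4 {c d : ℝ} (h : ∀ x, l.toVar x = c * x + d) :
      deriv (fun x => 2 * c * l.toVar x - l.skew * c) = fun _ => 2 * c * c := by
    funext x
    rw [deriv_sub_const, deriv_const_mul_field, (l.deriv_ortho h).2.2.2]
  have hγ {ν c : ℝ} (hc : c ^ 2 * ν = 1) (hl : ∀ φ x, l.generator φ x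
        = x * deriv (deriv φ) x + (ν - x) * deriv φ x) (hs : l.skew = 2 * c)
      (h : ∀ x, l.toVar x = c * x + -(c * ν)) :
      l.generator (l.ortho k) x = -(k : ℕ) * l.ortho k x := by
    obtain ⟨h0, h1, h2, h3⟩ := l.deriv_ortho h
    rw [hl]
    fin_cases k
    · simp [h0]
    · simp [h1, ortho, h]; ring
    · simp [h2, ortho, h, hs]
      linear_combination 2 * hc
  cases l with
  | normal =>
    have h (x : ℝ) : normal.toVar x = 1 * x + 0 := by simp [toVar]
    obtain ⟨h0, h1, h2, h3⟩ := deriv_ortho _ h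
    fin_cases k
    · simp [h0, generator]
    · simp [h1, ortho, toVar, generator]
    · simp only [Fin.reduceFinMk, generator, h2, h4 h]
      simp [ortho, toVar, skew]; ring
  | gammaPlus ν hν =>
    refine hγ (ν := ν) (c := (√ν)⁻¹) ?_ (fun _ _ => rfl) ?_ fun x => ?_
    · rw [inv_pow, Real.sq_sqrt hν.le]; field_simp
    · simp [skew]; ring
    · simp [toVar]; ring
  | gammaMinus ν hν =>
    refine hγ (ν := ν) (c := -(√ν)⁻¹) ?_ (fun _ _ => rfl) ?_ fun x => ?_
    · rw [neg_sq, inv_pow, Real.sq_sqrt hν.le]; field_simp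
    · simp [skew]; ring
    · simp [toVar]; ring

end NormalGamma.Law

namespace NormalGamma

variable {N p q : ℕ}

/-! ### The orthogonal basis on the product space -/

/-- The tensor products of the one-dimensional orthogonal polynomials. -/
noncomputable def tensor (l : Fin N → Law) (α : Fin N → Fin 3) (ω : Fin N → ℝ) : ℝ :=
  ∏ i, (l i).ortho (α i) (ω i)

/-- The squared norms of the functions `tensor`. -/
noncomputable def tensorWeight (l : Fin N → Law) (α : Fin N → Fin 3) : ℝ :=
  ∏ i, (l i).weight (α i)

/-- The total degree of a multi-index. -/
def degree (α : Fin N → Fin 3) : ℕ := ∑ i, (α i : ℕ)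

/-- The function with coefficients `c` in the basis `tensor`. -/
noncomputable def expansion (l : Fin N → Law) (c : (Fin N → Fin 3) → ℝ) (ω : Fin N → ℝ) : ℝ :=
  ∑ α, c α * tensor l α ω

instance (l : Fin N → Law) : IsProbabilityMeasure (prob l) := by
  unfold prob; infer_instance

theorem integral_tensor_mul_tensor (l : Fin N → Law) (α β : Fin N → Fin 3) :
    Integrable (fun ω => tensor l α ω * tensor l β ω) (prob l) ∧
    ∫ ω, tensor l α ω * tensor l β ω ∂(prob l) = if α = β then tensorWeight l α else 0 := by
  simp only [tensor, ← Finset.prod_mul_distrib]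
  refine ⟨Integrable.fintype_prod (f := fun i x => (l i).ortho (α i) x * (l i).ortho (β i) x)
    fun i => ((l i).integral_ortho_mul_ortho _ _).1, ?_⟩
  rw [prob, integral_fintype_prod_eq_prod
    (f := fun i x => (l i).ortho (α i) x * (l i).ortho (β i) x)]
  simp only [((l _).integral_ortho_mul_ortho _ _).2]
  split_ifs with h
  · simp [h, tensorWeight]
  · obtain ⟨i, hi⟩ := Function.ne_iff.1 h
    exact Finset.prod_eq_zero (Finset.mem_univ i) (if_neg hi)

theorem measurable_tensor (l : Fin N → Law) (α : Fin N → Fin 3) : Measurable (tensor l α) :=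
  Finset.measurable_fun_prod _ fun i _ =>
    ((l i).contDiff_ortho (α i)).continuous.measurable.comp (measurable_pi_apply i)

theorem memLp_tensor (l : Fin N → Law) (α : Fin N → Fin 3) : MemLp (tensor l α) 2 (prob l) := by
  rw [memLp_two_iff_integrable_sq (measurable_tensor l α).aestronglyMeasurable]
  simpa only [pow_two] using (integral_tensor_mul_tensor l α α).1

theorem memLp_expansion (l : Fin N → Law) (c : (Fin N → Fin 3) → ℝ) :
    MemLp (expansion l c) 2 (prob l) :=
  memLp_finsetSum _ fun α _ => (memLp_tensor l α).const_mul (c α)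

theorem integral_expansion_mul (l : Fin N → Law) (c d : (Fin N → Fin 3) → ℝ) :
    ∫ ω, expansion l c ω * expansion l d ω ∂(prob l) = ∑ α, c α * d α * tensorWeight l α := by
  have h (ω) : expansion l c ω * expansion l d ω =
      ∑ α, ∑ β, c α * d β * (tensor l α ω * tensor l β ω) := by
    simp only [expansion, Finset.sum_mul_sum]
    exact Finset.sum_congr rfl fun α _ => Finset.sum_congr rfl fun β _ => by ring
  have hi (α β) : Integrable (fun ω => c α * d β * (tensor l α ω * tensor l β ω)) (prob l) :=
    (integral_tensor_mul_tensor l α β).1.const_mul _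
  simp_rw [h]
  rw [integral_finsetSum _ fun α _ => integrable_finsetSum _ fun β _ => hi α β]
  refine Finset.sum_congr rfl fun α _ => ?_
  rw [integral_finsetSum _ fun β _ => hi α β]
  simp [integral_const_mul, (integral_tensor_mul_tensor l α _).2]

theorem expansion_one (l : Fin N → Law) : expansion l (Pi.single 0 1) = fun _ => 1 := by
  funext ω
  rw [expansion, Finset.sum_eq_single 0 (fun b _ hb => by simp [hb]) (by simp)]
  simp [tensor, Law.ortho]

theorem integral_expansion (l : Fin N → Law) (c : (Fin N → Fin 3) → ℝ) :
    ∫ ω, expansion l c ω ∂(prob l) = c 0 := by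
  have := integral_expansion_mul l c (Pi.single 0 1)
  rw [expansion_one, Finset.sum_eq_single 0 (fun b _ hb => by simp [hb]) (by simp)] at this
  simpa [tensorWeight, Law.weight] using this

theorem variance_expansion (l : Fin N → Law) (c : (Fin N → Fin 3) → ℝ) :
    variance (expansion l c) (prob l) = ∑ α with α ≠ 0, c α ^ 2 * tensorWeight l α := by
  rw [variance_eq_sub (memLp_expansion l c), integral_expansion]
  simp only [Pi.pow_apply, pow_two]
  rw [integral_expansion_mul, Finset.filter_ne', Finset.sum_erase_eq_sub (Finset.mem_univ _)]
  simp [tensorWeight, Law.weight]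

/-! ### The generator on the orthogonal basis -/

theorem tensor_update (l : Fin N → Law) (α : Fin N → Fin 3) (ω : Fin N → ℝ) (i : Fin N) (t : ℝ) :
    tensor l α (Function.update ω i t) =
      (∏ j ∈ Finset.univ.erase i, (l j).ortho (α j) (ω j)) * (l i).ortho (α i) t := by
  rw [tensor, ← Finset.prod_erase_mul _ _ (Finset.mem_univ i), Function.update_self]
  congr 1
  refine Finset.prod_congr rfl fun j hj => ?_
  rw [Function.update_of_ne (Finset.ne_of_mem_erase hj)]

/-- With the other coordinates frozen, a tensor product is a multiple of a one-dimensional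
eigenfunction; the eigenvalues `-α i` add up to `-|α|`. -/
theorem L_expansion (l : Fin N → Law) (c : (Fin N → Fin 3) → ℝ) (ω : Fin N → ℝ) :
    L l (expansion l c) ω = expansion l (fun α => -(degree α : ℝ) * c α) ω := by
  have h (i : Fin N) : (l i).generator (fun t => expansion l c (Function.update ω i t)) (ω i) =
      ∑ α, -((α i : ℕ) : ℝ) * (c α * tensor l α ω) := by
    simp only [expansion, tensor_update, ← mul_assoc]
    rw [Law.generator_sum _ _ _ fun α _ => contDiff_const.mul ((l i).contDiff_ortho _)]
    refine Finset.sum_congr rfl fun α _ => ?_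
    rw [Law.generator_const_mul, Law.generator_ortho, tensor,
      ← Finset.prod_erase_mul _ _ (Finset.mem_univ i)]
    ring
  simp only [L, h]
  rw [expansion, Finset.sum_comm]
  refine Finset.sum_congr rfl fun α _ => ?_
  rw [← Finset.sum_mul, degree]
  push_cast
  rw [Finset.sum_neg_distrib]
  ring

/-! ### Multilinear polynomials and their products -/

/-- The multilinear polynomial in the variables `Y` with coefficients `φ`. -/
noncomputable def multilin (l : Fin N → Law) (φ : Finset (Fin N) → ℝ) (ω : Fin N → ℝ) : ℝ :=
  ∑ S, φ S * ∏ i ∈ S, Y l i ω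

/-- A coefficient function concentrated on the sets of cardinality `p`. -/
def IsHomogeneous (p : ℕ) (φ : Finset (Fin N) → ℝ) : Prop := ∀ S, φ S ≠ 0 → S.card = p

/-- The sum of the indicator functions of two sets. -/
def indicatorAdd (S T : Finset (Fin N)) (i : Fin N) : Fin 3 :=
  if i ∈ S ∧ i ∈ T then 2 else if i ∈ S ∨ i ∈ T then 1 else 0

/-- The coefficients of a product of two monomials in the orthogonal basis. -/
noncomputable def monomialCoeff (l : Fin N → Law) (S T : Finset (Fin N)) (α : Fin N → Fin 3) : ℝ :=
  ∏ i, if i ∈ S ∧ i ∈ T then ![1, (l i).skew, 1] (α i) else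
    if i ∈ S ∨ i ∈ T then ![0, 1, 0] (α i) else ![1, 0, 0] (α i)

/-- The coefficients of a product of two multilinear polynomials in the orthogonal basis. -/
noncomputable def prodCoeff (l : Fin N → Law) (φ ψ : Finset (Fin N) → ℝ) (α : Fin N → Fin 3) : ℝ :=
  ∑ S, ∑ T, φ S * ψ T * monomialCoeff l S T α

/-- The coefficients of highest degree of a product of two multilinear polynomials. -/
noncomputable def topCoeff (φ ψ : Finset (Fin N) → ℝ) (α : Fin N → Fin 3) : ℝ :=
  ∑ S, ∑ T, if indicatorAdd S T = α then φ S * ψ T else 0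

/-- A shared index contributes `Y² = (Y² - sY - 1) + sY + 1`, and any other index a single basis
polynomial. -/
theorem prod_Y_mul_prod_Y (l : Fin N → Law) (S T : Finset (Fin N)) (ω : Fin N → ℝ) :
    (∏ i ∈ S, Y l i ω) * ∏ i ∈ T, Y l i ω = expansion l (monomialCoeff l S T) ω := by
  simp only [expansion, monomialCoeff, tensor, ← Finset.prod_mul_distrib]
  rw [← Fintype.prod_sum (fun i (k : Fin 3) => (if i ∈ S ∧ i ∈ T then ![1, (l i).skew, 1] k else
    if i ∈ S ∨ i ∈ T then ![0, 1, 0] k else ![1, 0, 0] k) * (l i).ortho k (ω i))]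
  rw [← Fintype.prod_ite_mem S, ← Fintype.prod_ite_mem T, ← Finset.prod_mul_distrib]
  refine Finset.prod_congr rfl fun i _ => ?_
  by_cases hS : i ∈ S <;> by_cases hT : i ∈ T <;>
    simp [hS, hT, Fin.sum_univ_three, Law.ortho, Y]
  ring

theorem multilin_mul (l : Fin N → Law) (φ ψ : Finset (Fin N) → ℝ) (ω : Fin N → ℝ) :
    multilin l φ ω * multilin l ψ ω = expansion l (prodCoeff l φ ψ) ω := by
  have h (S T : Finset (Fin N)) : (φ S * ∏ i ∈ S, Y l i ω) * (ψ T * ∏ i ∈ T, Y l i ω) =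
      ∑ α, φ S * ψ T * monomialCoeff l S T α * tensor l α ω := by
    rw [mul_mul_mul_comm, prod_Y_mul_prod_Y, expansion, Finset.mul_sum]
    exact Finset.sum_congr rfl fun _ _ => by ring
  rw [multilin, multilin, Finset.sum_mul_sum]
  simp only [h, expansion, prodCoeff, Finset.sum_mul]
  rw [Finset.sum_comm (s := (Finset.univ : Finset (Fin N → Fin 3)))]
  exact Finset.sum_congr rfl fun S _ => Finset.sum_comm

theorem multilin_eq_expansion (l : Fin N → Law) (φ : Finset (Fin N) → ℝ) :
    multilin l φ = expansion l (fun α => ∑ S, if indicatorAdd S ∅ = α then φ S else 0) := by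
  funext ω
  simp only [multilin, expansion, Finset.sum_mul, ite_mul, zero_mul]
  rw [Finset.sum_comm]
  refine Finset.sum_congr rfl fun S _ => ?_
  rw [Finset.sum_ite_eq Finset.univ, if_pos (Finset.mem_univ _), tensor,
    ← Fintype.prod_ite_mem S]
  congr 1
  refine Finset.prod_congr rfl fun i _ => ?_
  by_cases h : i ∈ S <;> simp [indicatorAdd, h, Y, Law.ortho]

theorem degree_indicatorAdd (S T : Finset (Fin N)) :
    degree (indicatorAdd S T) = S.card + T.card := by
  rw [degree, Finset.card_eq_sum_ones, Finset.card_eq_sum_ones, ← Fintype.sum_ite_mem S,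
    ← Fintype.sum_ite_mem T, ← Finset.sum_add_distrib]
  refine Finset.sum_congr rfl fun i _ => ?_
  by_cases hS : i ∈ S <;> by_cases hT : i ∈ T <;> simp [indicatorAdd, hS, hT]

theorem le_indicatorAdd {l : Fin N → Law} {S T : Finset (Fin N)} {α : Fin N → Fin 3}
    (h : monomialCoeff l S T α ≠ 0) (i : Fin N) : (α i : ℕ) ≤ indicatorAdd S T i := by
  have hi := Finset.prod_ne_zero_iff.1 h i (Finset.mem_univ i)
  unfold indicatorAdd
  generalize α i = k at hi ⊢
  by_cases hS : i ∈ S <;> by_cases hT : i ∈ T <;> simp only [hS, hT] at hi ⊢ <;>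
    fin_cases k <;> simp at hi ⊢

/-- Every `α` that occurs lies pointwise below `indicatorAdd S T`, so equality of degrees forces
equality. The basis being monic, the leading coefficient is `1` whatever the laws. -/
theorem monomialCoeff_eq {l : Fin N → Law} {S T : Finset (Fin N)} {α : Fin N → Fin 3}
    (h : S.card + T.card ≤ degree α) :
    monomialCoeff l S T α = if indicatorAdd S T = α then 1 else 0 := by
  split_ifs with he
  · subst he
    refine Finset.prod_eq_one fun i _ => ?_
    by_cases hS : i ∈ S <;> by_cases hT : i ∈ T <;> simp [indicatorAdd, hS, hT]
  · by_contra h0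
    rw [← degree_indicatorAdd] at h
    have hle := le_indicatorAdd h0
    have := (Finset.sum_eq_sum_iff_of_le fun i _ => hle i).1
      (le_antisymm (Finset.sum_le_sum fun i _ => hle i) h)
    exact he (funext fun i => Fin.ext (this i (Finset.mem_univ i)).symm)

theorem monomialCoeff_zero (l : Fin N → Law) (S T : Finset (Fin N)) :
    monomialCoeff l S T 0 = if S = T then 1 else 0 := by
  split_ifs with h
  · subst h
    refine Finset.prod_eq_one fun i _ => ?_
    by_cases hS : i ∈ S <;> simp [hS]
  · obtain ⟨i, hi⟩ : ∃ i, ¬(i ∈ S ↔ i ∈ T) := by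
      by_contra! hc
      exact h (Finset.ext hc)
    refine Finset.prod_eq_zero (Finset.mem_univ i) ?_
    by_cases hS : i ∈ S <;> by_cases hT : i ∈ T <;> simp [hS, hT] at hi ⊢

theorem prodCoeff_zero (l : Fin N → Law) (φ ψ : Finset (Fin N) → ℝ) :
    prodCoeff l φ ψ 0 = ∑ S, φ S * ψ S := by
  simp [prodCoeff, monomialCoeff_zero]

theorem prodCoeff_eq_topCoeff (l : Fin N → Law) {φ ψ : Finset (Fin N) → ℝ}
    (hφ : IsHomogeneous p φ) (hψ : IsHomogeneous q ψ) {α : Fin N → Fin 3}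
    (h : p + q ≤ degree α) : prodCoeff l φ ψ α = topCoeff φ ψ α := by
  refine Finset.sum_congr rfl fun S _ => Finset.sum_congr rfl fun T _ => ?_
  by_cases hS : φ S = 0
  · simp [hS]
  by_cases hT : ψ T = 0
  · simp [hT]
  rw [monomialCoeff_eq (by rwa [hφ S hS, hψ T hT])]
  simp

theorem topCoeff_eq_zero {φ ψ : Finset (Fin N) → ℝ}
    (hφ : IsHomogeneous p φ) (hψ : IsHomogeneous q ψ) {α : Fin N → Fin 3}
    (h : degree α ≠ p + q) : topCoeff φ ψ α = 0 := by
  refine Finset.sum_eq_zero fun S _ => Finset.sum_eq_zero fun T _ => ?_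
  split_ifs with he
  · by_contra h0
    refine h ?_
    rw [← he, degree_indicatorAdd, hφ S (left_ne_zero_of_mul h0), hψ T (right_ne_zero_of_mul h0)]
  · rfl

theorem L_multilin (l : Fin N → Law) {φ : Finset (Fin N) → ℝ} (hφ : IsHomogeneous p φ)
    (ω : Fin N → ℝ) : L l (multilin l φ) ω = -p * multilin l φ ω := by
  rw [multilin_eq_expansion, L_expansion, expansion, expansion, Finset.mul_sum]
  refine Finset.sum_congr rfl fun α _ => ?_
  rw [← mul_assoc]
  congr 1
  rw [Finset.mul_sum, Finset.mul_sum]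
  refine Finset.sum_congr rfl fun S _ => ?_
  split_ifs with h
  · by_cases hS : φ S = 0
    · simp [hS]
    · rw [← h, degree_indicatorAdd, hφ S hS]; simp
  · simp

/-- The factors have eigenvalues `-p` and `-q`, the `α`-component of the product has `-|α|`; the
definition of `Γ` then gives the multiplier. -/
theorem carreDuChamp_multilin (l : Fin N → Law) {φ ψ : Finset (Fin N) → ℝ}
    (hφ : IsHomogeneous p φ) (hψ : IsHomogeneous q ψ) :
    carreDuChamp l (multilin l φ) (multilin l ψ) =
      expansion l (fun α => (((p : ℝ) + q - degree α) / 2) * prodCoeff l φ ψ α) := by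
  funext ω
  have h : (fun ω => multilin l φ ω * multilin l ψ ω) = expansion l (prodCoeff l φ ψ) :=
    funext fun ω => multilin_mul l φ ψ ω
  have h' : multilin l φ ω * multilin l ψ ω = expansion l (prodCoeff l φ ψ) ω :=
    multilin_mul l φ ψ ω
  rw [carreDuChamp, h, L_multilin l hφ, L_multilin l hψ, L_expansion]
  have : (1 / 2) * (expansion l (fun α => -(degree α : ℝ) * prodCoeff l φ ψ α) ω -
      multilin l φ ω * (-q * multilin l ψ ω) - multilin l ψ ω * (-p * multilin l φ ω)) =
      (1 / 2) * (expansion l (fun α => -(degree α : ℝ) * prodCoeff l φ ψ α) ω +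
      (p + q) * expansion l (prodCoeff l φ ψ) ω) := by rw [← h']; ring
  rw [this]
  simp only [expansion, Finset.mul_sum, ← Finset.sum_add_distrib]
  exact Finset.sum_congr rfl fun α _ => by ring

/-! ### Inequalities for the coefficients of highest degree -/

/-- The squared norms of the multi-index basis in the normal case. -/
noncomputable def normalWeight (α : Fin N → Fin 3) : ℝ := ∏ i, if α i = 2 then 2 else 1

/-- The contraction of two coefficient functions. -/
noncomputable def contraction (φ ψ : Finset (Fin N) → ℝ) (a d : Finset (Fin N)) : ℝ :=
  ∑ b, if Disjoint a b ∧ Disjoint b d then φ (a ∪ b) * ψ (b ∪ d) else 0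

theorem normalWeight_indicatorAdd (S T : Finset (Fin N)) :
    normalWeight (indicatorAdd S T) = 2 ^ (S ∩ T).card := by
  rw [normalWeight, ← Finset.prod_const, ← Fintype.prod_ite_mem (S ∩ T)]
  refine Finset.prod_congr rfl fun i _ => ?_
  by_cases hS : i ∈ S <;> by_cases hT : i ∈ T <;> simp [indicatorAdd, hS, hT]

theorem indicatorAdd_eq_iff {S T S' T' : Finset (Fin N)} :
    indicatorAdd S T = indicatorAdd S' T' ↔ S ∩ T = S' ∩ T' ∧ S ∪ T = S' ∪ T' := by
  simp only [funext_iff, Finset.ext_iff, ← forall_and]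
  refine forall_congr' fun i => ?_
  by_cases h1 : i ∈ S <;> by_cases h2 : i ∈ T <;> by_cases h3 : i ∈ S' <;> by_cases h4 : i ∈ T' <;>
    simp [indicatorAdd, h1, h2, h3, h4]

/-- The number of ways to write `S = a ∪ b`, `T = c ∪ d`, `S' = a ∪ c`, `T' = b ∪ d` as disjoint
unions. -/
theorem card_splittings (S T S' T' : Finset (Fin N)) :
    (Finset.univ.filter fun y : (Finset (Fin N) × Finset (Fin N)) ×
        (Finset (Fin N) × Finset (Fin N)) =>
      ((Disjoint y.1.1 y.2.1 ∧ Disjoint y.2.1 y.1.2) ∧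
        (Disjoint y.1.1 y.2.2 ∧ Disjoint y.2.2 y.1.2)) ∧
      (y.1.1 ∪ y.2.1 = S ∧ y.2.2 ∪ y.1.2 = T) ∧
        (y.1.1 ∪ y.2.2 = S' ∧ y.2.1 ∪ y.1.2 = T')).card =
    if indicatorAdd S T = indicatorAdd S' T' then 2 ^ (S ∩ T).card else 0 := by
  simp only [indicatorAdd_eq_iff]
  split_ifs with h
  · obtain ⟨h1, h2⟩ := h
    simp only [Finset.ext_iff, Finset.mem_inter, Finset.mem_union] at h1 h2
    rw [← Finset.card_powerset]
    -- An index in `S ∩ T` lies either in `a ∩ d` or in `b ∩ c`: this is the only freedom, recorded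
    -- by `x = a ∩ (S ∩ T)`. Every other index is placed by its membership in `S, T, S', T'`.
    refine Finset.card_nbij' (fun y => y.1.1 ∩ (S ∩ T))
      (fun x => ((x ∪ ((S ∩ S') \ T), x ∪ ((T ∩ T') \ S)),
        (((S ∩ T) \ x) ∪ ((S ∩ T') \ T), ((S ∩ T) \ x) ∪ ((T ∩ S') \ S)))) ?_ ?_ ?_ ?_
    · intro y _
      exact Finset.mem_coe.2 (Finset.mem_powerset.2 Finset.inter_subset_right)
    · intro x hx
      simp only [Finset.coe_powerset, Set.mem_preimage, Set.mem_powerset_iff,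
        Finset.coe_subset] at hx
      simp only [Finset.coe_filter, Finset.mem_univ, true_and, Set.mem_ofPred_eq,
        Finset.disjoint_left, Finset.ext_iff, Finset.mem_union, Finset.mem_sdiff,
        Finset.mem_inter]
      refine ⟨⟨⟨?_, ?_⟩, ?_, ?_⟩, ⟨?_, ?_⟩, ?_, ?_⟩ <;> intro i <;> have := h1 i <;>
        have := h2 i <;> have := @hx i <;> grind
    · rintro ⟨⟨a, d⟩, b, c⟩ hy
      simp only [Finset.coe_filter, Finset.mem_univ, true_and, Set.mem_ofPred_eq,
        Finset.disjoint_left] at hy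
      obtain ⟨⟨⟨a1, a2⟩, a3, a4⟩, ⟨rfl, rfl⟩, rfl, rfl⟩ := hy
      clear h1 h2
      simp only [Prod.mk.injEq]
      refine ⟨⟨?_, ?_⟩, ?_, ?_⟩ <;> ext i <;>
        simp only [Finset.mem_union, Finset.mem_sdiff, Finset.mem_inter] <;>
        have := @a1 i <;> have := @a2 i <;> have := @a3 i <;> have := @a4 i <;> clear a1 a2 a3 a4 <;>
        by_cases i ∈ a <;> by_cases i ∈ b <;> by_cases i ∈ c <;> by_cases i ∈ d <;> simp_all
    · intro x hx
      simp only [Finset.coe_powerset, Set.mem_preimage, Set.mem_powerset_iff,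
        Finset.coe_subset] at hx
      ext i
      have := @hx i
      simp only [Finset.mem_union, Finset.mem_sdiff, Finset.mem_inter] at this ⊢
      tauto
  · rw [Finset.card_eq_zero, Finset.filter_eq_empty_iff]
    rintro ⟨⟨a, d⟩, b, c⟩ - ⟨⟨⟨a1, a2⟩, a3, a4⟩, ⟨rfl, rfl⟩, rfl, rfl⟩
    simp only [Finset.disjoint_left] at a1 a2 a3 a4
    refine h ⟨?_, ?_⟩ <;> ext i <;> have := @a1 i <;> have := @a2 i <;> have := @a3 i <;>
      have := @a4 i <;> clear h a1 a2 a3 a4 <;> simp only [Finset.mem_union, Finset.mem_inter] <;>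
      by_cases i ∈ a <;> by_cases i ∈ b <;> by_cases i ∈ c <;> by_cases i ∈ d <;> simp_all

theorem topCoeff_eq_sum_prod (φ ψ : Finset (Fin N) → ℝ) (α : Fin N → Fin 3) :
    topCoeff φ ψ α = ∑ x : Finset (Fin N) × Finset (Fin N),
      if indicatorAdd x.1 x.2 = α then φ x.1 * ψ x.2 else 0 :=
  (Fintype.sum_prod_type' fun S T => if indicatorAdd S T = α then φ S * ψ T else 0).symm

/-- Double counting: both sides sum the same products over quadruples `(S, T, S', T')`. The normal
weight `2 ^ |S ∩ T|` is the number of ways in which such a quadruple arises from the sets `a, b, c,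
d` of two contractions. -/
theorem sum_normalWeight_mul_topCoeff (φ₁ φ₂ ψ₁ ψ₂ : Finset (Fin N) → ℝ) :
    ∑ α, normalWeight α * (topCoeff φ₁ φ₂ α * topCoeff ψ₁ ψ₂ α) =
      ∑ a, ∑ d, contraction φ₁ ψ₂ a d * contraction ψ₁ φ₂ a d := by
  have hl (α : Fin N → Fin 3) : normalWeight α * (topCoeff φ₁ φ₂ α * topCoeff ψ₁ ψ₂ α) =
      ∑ x : (Finset (Fin N) × Finset (Fin N)) × (Finset (Fin N) × Finset (Fin N)),
        if α = indicatorAdd x.1.1 x.1.2 then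
          (if indicatorAdd x.2.1 x.2.2 = α then normalWeight α * ((φ₁ x.1.1 * φ₂ x.1.2) *
            (ψ₁ x.2.1 * ψ₂ x.2.2)) else 0) else 0 := by
    rw [topCoeff_eq_sum_prod, topCoeff_eq_sum_prod, Finset.sum_mul_sum]
    simp only [Finset.mul_sum]
    refine Eq.trans ?_ (Fintype.sum_prod_type _).symm
    refine Finset.sum_congr rfl fun x _ => Finset.sum_congr rfl fun y _ => ?_
    by_cases h1 : indicatorAdd x.1 x.2 = α <;> by_cases h2 : indicatorAdd y.1 y.2 = α <;>
      simp [h1, h2, eq_comm (a := α)]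
  have hr (a d : Finset (Fin N)) : contraction φ₁ ψ₂ a d * contraction ψ₁ φ₂ a d =
      ∑ y : Finset (Fin N) × Finset (Fin N),
        if (Disjoint a y.1 ∧ Disjoint y.1 d) ∧ (Disjoint a y.2 ∧ Disjoint y.2 d) then
          (φ₁ (a ∪ y.1) * φ₂ (y.2 ∪ d)) * (ψ₁ (a ∪ y.2) * ψ₂ (y.1 ∪ d)) else 0 := by
    simp only [contraction, Finset.sum_mul_sum]
    rw [Fintype.sum_prod_type]
    refine Finset.sum_congr rfl fun b _ => Finset.sum_congr rfl fun c _ => ?_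
    rw [ite_zero_mul_ite_zero]
    split_ifs
    · ring
    · rfl
  simp only [hl, hr]
  rw [Finset.sum_comm]
  simp only [Finset.sum_ite_eq', Finset.mem_univ, if_true]
  rw [← Fintype.sum_prod_type']
  rw [← Fintype.sum_prod_type' (f := fun (x : Finset (Fin N) × Finset (Fin N))
    (y : Finset (Fin N) × Finset (Fin N)) =>
      if (Disjoint x.1 y.1 ∧ Disjoint y.1 x.2) ∧ (Disjoint x.1 y.2 ∧ Disjoint y.2 x.2) then
          (φ₁ (x.1 ∪ y.1) * φ₂ (y.2 ∪ x.2)) * (ψ₁ (x.1 ∪ y.2) * ψ₂ (y.1 ∪ x.2)) else 0)]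
  have key (x : (Finset (Fin N) × Finset (Fin N)) × (Finset (Fin N) × Finset (Fin N))) :
      (if indicatorAdd x.2.1 x.2.2 = indicatorAdd x.1.1 x.1.2 then
        normalWeight (indicatorAdd x.1.1 x.1.2) * ((φ₁ x.1.1 * φ₂ x.1.2) *
            (ψ₁ x.2.1 * ψ₂ x.2.2)) else 0) =
      ∑ y : (Finset (Fin N) × Finset (Fin N)) × (Finset (Fin N) × Finset (Fin N)),
        if x = ((y.1.1 ∪ y.2.1, y.2.2 ∪ y.1.2), (y.1.1 ∪ y.2.2, y.2.1 ∪ y.1.2)) then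
          (if (Disjoint y.1.1 y.2.1 ∧ Disjoint y.2.1 y.1.2) ∧
            (Disjoint y.1.1 y.2.2 ∧ Disjoint y.2.2 y.1.2) then
          (φ₁ x.1.1 * φ₂ x.1.2) * (ψ₁ x.2.1 * ψ₂ x.2.2) else 0) else 0 := by
    obtain ⟨⟨S, T⟩, S', T'⟩ := x
    have := card_splittings S T S' T'
    simp only [Prod.mk.injEq, ← ite_and, ← Finset.sum_filter, Finset.sum_const, nsmul_eq_mul]
    rw [Finset.filter_congr (q := fun y => ((Disjoint y.1.1 y.2.1 ∧ Disjoint y.2.1 y.1.2) ∧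
        (Disjoint y.1.1 y.2.2 ∧ Disjoint y.2.2 y.1.2)) ∧
      (y.1.1 ∪ y.2.1 = S ∧ y.2.2 ∪ y.1.2 = T) ∧
        (y.1.1 ∪ y.2.2 = S' ∧ y.2.1 ∪ y.1.2 = T')) (fun y _ => by
          simp only [eq_comm (a := S), eq_comm (a := T), eq_comm (a := S'), eq_comm (a := T')]
          tauto), this, normalWeight_indicatorAdd]
    simp only [eq_comm (a := indicatorAdd S' T')]
    split_ifs <;> simp
  simp only [key]
  rw [Finset.sum_comm]
  refine Finset.sum_congr rfl fun y _ => ?_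
  rw [Finset.sum_ite_eq' Finset.univ, if_pos (Finset.mem_univ _)]

theorem contraction_comm (φ ψ : Finset (Fin N) → ℝ) (a d : Finset (Fin N)) :
    contraction φ ψ a d = contraction ψ φ d a := by
  refine Finset.sum_congr rfl fun b _ => ?_
  simp only [disjoint_comm, Finset.union_comm, and_comm, mul_comm]

theorem contraction_of_card {φ ψ : Finset (Fin N) → ℝ} (hφ : IsHomogeneous p φ)
    {a d : Finset (Fin N)} (ha : a.card = p) : contraction φ ψ a d = φ a * ψ d := by
  rw [contraction, Finset.sum_eq_single ∅ _ (by simp)]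
  · simp
  · intro b _ hb
    split_ifs with h
    · by_contra h0
      have h1 := hφ _ (left_ne_zero_of_mul h0)
      rw [Finset.card_union_of_disjoint h.1] at h1
      exact hb (Finset.card_eq_zero.1 (by omega))
    · rfl

theorem contraction_empty (φ ψ : Finset (Fin N) → ℝ) :
    contraction φ ψ ∅ ∅ = ∑ S, φ S * ψ S := by
  simp [contraction]

theorem sum_homogeneous {φ : Finset (Fin N) → ℝ} (hφ : IsHomogeneous p φ)
    (h : Finset (Fin N) → ℝ) (hh : ∀ S, φ S = 0 → h S = 0) :
    ∑ S with S.card = p, h S = ∑ S, h S := by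
  refine Finset.sum_filter_of_ne fun S _ h0 => hφ S fun h1 => h0 (hh S h1)

/-- In the rows `|a| = p` nothing is left to contract and the matrix is `φ a * ψ d`; these rows
alone give the bound. -/
theorem topCoeff_ge_of_lt {φ ψ : Finset (Fin N) → ℝ} (hφ : IsHomogeneous p φ) :
    (∑ S, φ S ^ 2) * ∑ S, ψ S ^ 2 ≤ ∑ α, normalWeight α * topCoeff φ ψ α ^ 2 := by
  simp only [pow_two (topCoeff _ _ _), sum_normalWeight_mul_topCoeff]
  rw [← sum_homogeneous hφ (fun S => φ S ^ 2) (by simp +contextual), Finset.sum_mul_sum]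
  refine (Finset.sum_le_sum fun a ha => ?_).trans (Finset.sum_le_sum_of_subset_of_nonneg
    (Finset.filter_subset _ _) fun a _ _ => Finset.sum_nonneg fun d _ => mul_self_nonneg _)
  refine le_of_eq (Finset.sum_congr rfl fun d _ => ?_)
  rw [contraction_of_card hφ (Finset.mem_filter.1 ha).2]
  ring

/-- One copy of the square comes from the full contraction `a = d = ∅`, the other from the rows `|a|
= q`; they are distinct as `q ≠ 0`. -/
theorem topCoeff_self_ge {ψ : Finset (Fin N) → ℝ} (hψ : IsHomogeneous q ψ) (hq : q ≠ 0) :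
    2 * (∑ S, ψ S ^ 2) ^ 2 ≤ ∑ α, normalWeight α * topCoeff ψ ψ α ^ 2 := by
  simp only [pow_two (topCoeff _ _ _), sum_normalWeight_mul_topCoeff]
  have hn (a : Finset (Fin N)) : 0 ≤ ∑ d, contraction ψ ψ a d * contraction ψ ψ a d :=
    Finset.sum_nonneg fun d _ => mul_self_nonneg _
  have h0 : (∑ S, ψ S ^ 2) ^ 2 ≤ ∑ d, contraction ψ ψ ∅ d * contraction ψ ψ ∅ d := by
    refine le_trans (le_of_eq ?_) (Finset.single_le_sum (f := fun d => contraction ψ ψ ∅ d *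
      contraction ψ ψ ∅ d) (fun d _ => mul_self_nonneg _) (Finset.mem_univ ∅))
    simp only [contraction_empty, ← pow_two]
  have h1 : (∑ S, ψ S ^ 2) ^ 2 =
      ∑ a with a.card = q, ∑ d, contraction ψ ψ a d * contraction ψ ψ a d := by
    rw [pow_two, Finset.sum_mul_sum, ← sum_homogeneous hψ _ (by simp +contextual)]
    refine Finset.sum_congr rfl fun a ha => Finset.sum_congr rfl fun d _ => ?_
    rw [contraction_of_card hψ (Finset.mem_filter.1 ha).2]
    ring
  have h2 : (∅ : Finset (Fin N)) ∉ Finset.univ.filter fun a => a.card = q := by simp [hq.symm]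
  calc 2 * (∑ S, ψ S ^ 2) ^ 2 ≤ _ := by
        rw [two_mul]; exact add_le_add h0 h1.le
    _ = ∑ a ∈ insert ∅ (Finset.univ.filter fun a => a.card = q),
        ∑ d, contraction ψ ψ a d * contraction ψ ψ a d := (Finset.sum_insert h2).symm
    _ ≤ _ := Finset.sum_le_sum_of_subset_of_nonneg (Finset.subset_univ _) fun a _ _ => hn a

/-- With `M = contraction φ ψ`, the two weighted sums are `∑ M a d ^ 2` and `∑ M a d * M d a`, and
they differ by half the squared norm of `M - Mᵀ`. On the block `|a| = |d| = p`, Lagrange's identity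
evaluates that as the Gram determinant of `φ` and `ψ`. -/
theorem topCoeff_cross_le {φ ψ : Finset (Fin N) → ℝ} (hφ : IsHomogeneous p φ)
    (hψ : IsHomogeneous p ψ) :
    (∑ S, φ S ^ 2) * (∑ S, ψ S ^ 2) - (∑ S, φ S * ψ S) ^ 2 +
      ∑ α, normalWeight α * (topCoeff φ φ α * topCoeff ψ ψ α) ≤
      ∑ α, normalWeight α * topCoeff φ ψ α ^ 2 := by
  simp only [pow_two (topCoeff _ _ _), sum_normalWeight_mul_topCoeff]
  set M := contraction φ ψ with hM
  have hc (a d) : contraction ψ φ a d = M d a := contraction_comm _ _ _ _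
  simp only [hc]
  have h1 : ∑ a, ∑ d, M a d * M a d - ∑ a, ∑ d, M a d * M d a
      = 1 / 2 * ∑ a, ∑ d, (M a d - M d a) ^ 2 := by
    have hs : ∑ a, ∑ d, M d a * M d a = ∑ a, ∑ d, M a d * M a d := Finset.sum_comm
    have he (a d) : (M a d - M d a) ^ 2 = M a d * M a d + M d a * M d a - 2 * (M a d * M d a) := by
      ring
    simp only [he, Finset.sum_sub_distrib, Finset.sum_add_distrib, ← Finset.mul_sum, hs]
    ring
  have h2 : ∑ a with a.card = p, ∑ d with d.card = p, (M a d - M d a) ^ 2 ≤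
      ∑ a, ∑ d, (M a d - M d a) ^ 2 := by
    refine (Finset.sum_le_sum fun a _ => Finset.sum_le_sum_of_subset_of_nonneg
      (Finset.filter_subset _ _) fun d _ _ => sq_nonneg _).trans
      (Finset.sum_le_sum_of_subset_of_nonneg
      (Finset.filter_subset _ _) fun a _ _ => Finset.sum_nonneg fun d _ => sq_nonneg _)
  have h3 : ∑ a with a.card = p, ∑ d with d.card = p, (M a d - M d a) ^ 2 =
      2 * ((∑ S, φ S ^ 2) * (∑ S, ψ S ^ 2) - (∑ S, φ S * ψ S) ^ 2) := by
    have e (a) (ha : a ∈ Finset.univ.filter fun a : Finset (Fin N) => a.card = p) (d)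
        (hd : d ∈ Finset.univ.filter fun a : Finset (Fin N) => a.card = p) :
        (M a d - M d a) ^ 2 = φ a ^ 2 * ψ d ^ 2 + ψ a ^ 2 * φ d ^ 2
          - 2 * ((φ a * ψ a) * (φ d * ψ d)) := by
      rw [hM, contraction_of_card hφ (Finset.mem_filter.1 ha).2,
        contraction_of_card hφ (Finset.mem_filter.1 hd).2]
      ring
    rw [Finset.sum_congr rfl fun a ha => Finset.sum_congr rfl fun d hd => e a ha d hd]
    simp only [Finset.sum_sub_distrib, Finset.sum_add_distrib, ← Finset.mul_sum, ← Finset.sum_mul]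
    rw [sum_homogeneous hφ (fun S => φ S ^ 2) (by simp +contextual),
      sum_homogeneous hψ (fun S => ψ S ^ 2) (by simp +contextual),
      sum_homogeneous hψ (fun S => φ S * ψ S) (by simp +contextual)]
    ring
  linarith

/-! ### The excess of the weights over the normal case -/

theorem two_pow_mul_centralBinom_sub_le {k p : ℕ} (h : k ≤ p) :
    2 ^ k * Nat.centralBinom (p - k) ≤ Nat.centralBinom p := by
  induction k with
  | zero => simp
  | succ k ih =>
    refine le_trans ?_ (ih (by omega))
    obtain ⟨m, hm⟩ : ∃ m, p - k = m + 1 := ⟨p - k - 1, by omega⟩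
    have hm' : p - (k + 1) = m := by omega
    rw [hm, hm', pow_succ, mul_assoc]
    refine Nat.mul_le_mul_left _ (Nat.le_of_mul_le_mul_left (c := m + 1) ?_ m.succ_pos)
    rw [Nat.succ_mul_centralBinom_succ, ← mul_assoc]
    exact Nat.mul_le_mul_right _ (by omega)

/-- If `k` indices are shared, the pair is determined by choosing `S \ T`, of size `p - k`, in a
symmetric difference of size `2(p - k)`. The weight is `2 ^ k`, so `two_pow_mul_centralBinom_sub_le`
applies. -/
theorem normalWeight_mul_card_le (α : Fin N → Fin 3) :
    normalWeight α * ((Finset.univ.filter fun x : Finset (Fin N) × Finset (Fin N) =>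
      indicatorAdd x.1 x.2 = α ∧ x.1.card = p ∧ x.2.card = p).card : ℝ) ≤ Nat.centralBinom p := by
  rcases Finset.eq_empty_or_nonempty (Finset.univ.filter
    fun x : Finset (Fin N) × Finset (Fin N) =>
      indicatorAdd x.1 x.2 = α ∧ x.1.card = p ∧ x.2.card = p) with h | ⟨⟨S, T⟩, h⟩
  · rw [h]; simp
  simp only [Finset.mem_filter, Finset.mem_univ, true_and] at h
  obtain ⟨rfl, hS, hT⟩ := h
  rw [normalWeight_indicatorAdd]
  have hk : (S ∩ T).card ≤ p := hS ▸ Finset.card_le_card Finset.inter_subset_left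
  have hB : ((S ∪ T) \ (S ∩ T)).card = 2 * (p - (S ∩ T).card) := by
    rw [Finset.card_sdiff_of_subset (Finset.inter_subset_left.trans Finset.subset_union_left)]
    have := Finset.card_union_add_card_inter S T
    omega
  have hc : (Finset.univ.filter fun x : Finset (Fin N) × Finset (Fin N) =>
      indicatorAdd x.1 x.2 = indicatorAdd S T ∧ x.1.card = p ∧ x.2.card = p).card ≤
      Nat.centralBinom (p - (S ∩ T).card) := by
    rw [Nat.centralBinom_eq_two_mul_choose, ← hB, ← Finset.card_powersetCard]
    refine Finset.card_le_card_of_injOn (fun x => x.1 \ x.2) ?_ ?_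
    · rintro ⟨S', T'⟩ hx
      simp only [Finset.coe_filter, Finset.mem_univ, true_and, Set.mem_ofPred_eq,
        indicatorAdd_eq_iff] at hx
      obtain ⟨⟨h1, h2⟩, h3, h4⟩ := hx
      rw [Finset.mem_coe, Finset.mem_powersetCard, ← h1, ← h2, ← h3]
      constructor
      · intro i
        simp only [Finset.mem_sdiff, Finset.mem_union, Finset.mem_inter]
        tauto
      · have := Finset.card_sdiff_add_card_inter S' T'
        simp only
        omega
    · rintro ⟨S₁, T₁⟩ h₁ ⟨S₂, T₂⟩ h₂ he
      simp only [Finset.coe_filter, Finset.mem_univ, true_and, Set.mem_ofPred_eq] at h₁ h₂ he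
      obtain ⟨h1, h2⟩ := indicatorAdd_eq_iff.1 (h₁.1.trans h₂.1.symm)
      simp only [Finset.ext_iff, Finset.mem_sdiff, Finset.mem_union, Finset.mem_inter] at h1 h2 he
      refine Prod.ext (Finset.ext fun i => ?_) (Finset.ext fun i => ?_) <;>
        have := h1 i <;> have := h2 i <;> have := he i <;> simp only <;> tauto
  exact_mod_cast (Nat.mul_le_mul_left _ hc).trans (two_pow_mul_centralBinom_sub_le hk)

theorem normalWeight_mul_topCoeff_sq_le {φ : Finset (Fin N) → ℝ} (hφ : IsHomogeneous p φ)
    (α : Fin N → Fin 3) :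
    normalWeight α * topCoeff φ φ α ^ 2 ≤ Nat.centralBinom p *
      ∑ x : Finset (Fin N) × Finset (Fin N),
        if indicatorAdd x.1 x.2 = α then φ x.1 ^ 2 * φ x.2 ^ 2 else 0 := by
  set s := Finset.univ.filter fun x : Finset (Fin N) × Finset (Fin N) =>
      indicatorAdd x.1 x.2 = α ∧ x.1.card = p ∧ x.2.card = p with hs
  have ht : topCoeff φ φ α = ∑ x ∈ s, φ x.1 * φ x.2 := by
    rw [topCoeff_eq_sum_prod, ← Finset.sum_filter]
    refine (Finset.sum_subset (fun x hx => ?_) fun x hx hxs => ?_).symm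
    · simp only [hs, Finset.mem_filter] at hx ⊢
      exact ⟨hx.1, hx.2.1⟩
    · by_contra h0
      refine hxs ?_
      simp only [hs, Finset.mem_filter] at hx ⊢
      exact ⟨hx.1, hx.2, hφ _ (left_ne_zero_of_mul h0), hφ _ (right_ne_zero_of_mul h0)⟩
  have hg : 0 ≤ normalWeight α := Finset.prod_nonneg fun i _ => by split_ifs <;> norm_num
  calc normalWeight α * topCoeff φ φ α ^ 2
      ≤ normalWeight α * (s.card * ∑ x ∈ s, (φ x.1 * φ x.2) ^ 2) := by
        rw [ht]; exact mul_le_mul_of_nonneg_left sq_sum_le_card_mul_sum_sq hg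
    _ = normalWeight α * s.card * ∑ x ∈ s, (φ x.1 * φ x.2) ^ 2 := (mul_assoc _ _ _).symm
    _ ≤ _ := by
        refine mul_le_mul (normalWeight_mul_card_le α) ?_
          (Finset.sum_nonneg fun _ _ => sq_nonneg _) (Nat.cast_nonneg _)
        rw [← Finset.sum_filter]
        simp only [mul_pow]
        refine Finset.sum_le_sum_of_subset_of_nonneg (fun x hx => ?_) fun x _ _ => by positivity
        simp only [hs, Finset.mem_filter] at hx ⊢
        exact ⟨hx.1, hx.2.1⟩

/-- A value `2` of `α` is an index shared by both monomials, so a union bound over that index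
produces the influences. -/
theorem sum_normalWeight_mul_topCoeff_sq_le {φ : Finset (Fin N) → ℝ} (hφ : IsHomogeneous p φ) :
    ∑ α with ∃ i, α i = 2, normalWeight α * topCoeff φ φ α ^ 2 ≤
      Nat.centralBinom p * ∑ i, (∑ S with i ∈ S, φ S ^ 2) ^ 2 := by
  refine (Finset.sum_le_sum fun α _ => normalWeight_mul_topCoeff_sq_le hφ α).trans ?_
  rw [← Finset.mul_sum, Finset.sum_comm]
  refine mul_le_mul_of_nonneg_left ?_ (Nat.cast_nonneg _)
  have h (i : Fin N) : (∑ S with i ∈ S, φ S ^ 2) ^ 2 =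
      ∑ x : Finset (Fin N) × Finset (Fin N),
        if i ∈ x.1 ∧ i ∈ x.2 then φ x.1 ^ 2 * φ x.2 ^ 2 else 0 := by
    rw [pow_two, Finset.sum_filter, Finset.sum_mul_sum, Fintype.sum_prod_type]
    simp only [ite_zero_mul_ite_zero]
  simp only [h]
  rw [Finset.sum_comm (s := (Finset.univ : Finset (Fin N)))]
  refine Finset.sum_le_sum fun x _ => ?_
  rw [Finset.sum_ite_eq]
  have hn (i : Fin N) : 0 ≤ if i ∈ x.1 ∧ i ∈ x.2 then φ x.1 ^ 2 * φ x.2 ^ 2 else 0 := by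
    split_ifs <;> positivity
  split_ifs with hx
  · obtain ⟨i, hi⟩ := (Finset.mem_filter.1 hx).2
    have hi' : i ∈ x.1 ∧ i ∈ x.2 := by
      unfold indicatorAdd at hi
      by_contra hc
      rw [if_neg hc] at hi
      split_ifs at hi <;> simp at hi
    refine le_trans (le_of_eq ?_) (Finset.single_le_sum (fun i _ => hn i) (Finset.mem_univ i))
    rw [if_pos hi']
  · exact Finset.sum_nonneg fun i _ => hn i

/-- The Cauchy–Schwarz inequality for weighted sums. -/
theorem sum_weight_mul_le_sqrt_mul_sqrt {ι : Type*} (s : Finset ι) (w a b : ι → ℝ)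
    (hw : ∀ i ∈ s, 0 ≤ w i) :
    ∑ i ∈ s, w i * (a i * b i) ≤ √(∑ i ∈ s, w i * a i ^ 2) * √(∑ i ∈ s, w i * b i ^ 2) := by
  have h := Real.sum_mul_le_sqrt_mul_sqrt s (fun i => √(w i) * a i) (fun i => √(w i) * b i)
  have e (c d : ι → ℝ) : ∀ i ∈ s, √(w i) * c i * (√(w i) * d i) = w i * (c i * d i) :=
    fun i hi => by linear_combination (c i * d i) * Real.mul_self_sqrt (hw i hi)
  simp only [pow_two] at h ⊢
  rwa [Finset.sum_congr rfl (e a b), Finset.sum_congr rfl (e a a),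
    Finset.sum_congr rfl (e b b)] at h

theorem weight_eq (l : Law) (k : Fin 3) : l.weight k = if k = 2 then l.v else 1 := by
  fin_cases k <;> simp [Law.weight]

theorem normalWeight_nonneg (α : Fin N → Fin 3) : 0 ≤ normalWeight α :=
  Finset.prod_nonneg fun i _ => by split_ifs <;> norm_num

theorem normalWeight_le_tensorWeight (l : Fin N → Law) (α : Fin N → Fin 3) :
    normalWeight α ≤ tensorWeight l α := by
  refine Finset.prod_le_prod (fun i _ => by split_ifs <;> norm_num) fun i _ => ?_
  rw [weight_eq]
  split_ifs
  · exact (l i).two_le_v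
  · exact le_rfl

theorem tensorWeight_nonneg (l : Fin N → Law) (α : Fin N → Fin 3) : 0 ≤ tensorWeight l α :=
  (normalWeight_nonneg α).trans (normalWeight_le_tensorWeight l α)

theorem v_le_vMax (l : Fin N → Law) (i : Fin N) : (l i).v ≤ vMax l :=
  le_ciSup (f := fun i => (l i).v) (Set.finite_range _).bddAbove i

/-- At most `k` entries of `α` equal `2`, each costing a factor at most `vMax / 2 ≥ 1`. The index
`i₀` makes the supremum one over a nonempty set. -/
theorem tensorWeight_le (l : Fin N → Law) {α : Fin N → Fin 3} {k : ℕ} (hα : degree α ≤ k + k)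
    (i₀ : Fin N) : tensorWeight l α ≤ normalWeight α * (vMax l / 2) ^ k := by
  have hv : 1 ≤ vMax l / 2 := by linarith [v_le_vMax l i₀, (l i₀).two_le_v]
  have hc : (Finset.univ.filter fun i => α i = 2).card ≤ k := by
    have : ∑ i, (if α i = 2 then 2 else 0) ≤ degree α :=
      Finset.sum_le_sum fun i _ => by split_ifs with h <;> simp [h]
    rw [← Finset.sum_filter, Finset.sum_const, smul_eq_mul] at this
    omega
  calc tensorWeight l α ≤ ∏ i, (if α i = 2 then 2 else 1) * (if α i = 2 then vMax l / 2 else 1) := by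
        refine Finset.prod_le_prod (fun i _ => ?_) fun i _ => ?_ <;> rw [weight_eq]
        · split_ifs
          · linarith [(l i).two_le_v]
          · exact zero_le_one
        · split_ifs
          · linarith [v_le_vMax l i]
          · simp
    _ = normalWeight α * (vMax l / 2) ^ (Finset.univ.filter fun i => α i = 2).card := by
        rw [Finset.prod_mul_distrib, ← Finset.prod_filter (fun i => α i = 2) (fun _ => vMax l / 2),
          Finset.prod_const, normalWeight]
    _ ≤ _ := mul_le_mul_of_nonneg_left (pow_le_pow_right₀ hv hc) (normalWeight_nonneg α)

/-- The weights agree unless `α` takes the value `2`, and the top coefficients live in degree `2p`.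
Cauchy–Schwarz separates `φ` from `ψ`. -/
theorem sum_weight_excess_le (l : Fin N → Law) {φ ψ : Finset (Fin N) → ℝ}
    (hφ : IsHomogeneous p φ) (hψ : IsHomogeneous p ψ) (i₀ : Fin N) :
    ∑ α, (tensorWeight l α - normalWeight α) * (topCoeff φ φ α * topCoeff ψ ψ α) ≤
      ((vMax l / 2) ^ p - 1) * (Nat.centralBinom p *
        (√(∑ i, (∑ S with i ∈ S, φ S ^ 2) ^ 2) * √(∑ i, (∑ S with i ∈ S, ψ S ^ 2) ^ 2))) := by
  have hv : 1 ≤ vMax l / 2 := by linarith [v_le_vMax l i₀, (l i₀).two_le_v]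
  have hρ : 0 ≤ (vMax l / 2) ^ p - 1 := by linarith [one_le_pow₀ hv (n := p)]
  have h1 (α : Fin N → Fin 3) :
      (tensorWeight l α - normalWeight α) * (topCoeff φ φ α * topCoeff ψ ψ α) ≤
      if ∃ i, α i = 2 then ((vMax l / 2) ^ p - 1) *
        (normalWeight α * (|topCoeff φ φ α| * |topCoeff ψ ψ α|)) else 0 := by
    split_ifs with h
    · by_cases hd : degree α = p + p
      · calc _ ≤ (tensorWeight l α - normalWeight α) * (|topCoeff φ φ α| * |topCoeff ψ ψ α|) := by
              rw [← abs_mul]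
              exact mul_le_mul_of_nonneg_left (le_abs_self _)
                (sub_nonneg.2 (normalWeight_le_tensorWeight l α))
          _ ≤ (((vMax l / 2) ^ p - 1) * normalWeight α) *
              (|topCoeff φ φ α| * |topCoeff ψ ψ α|) := by
              refine mul_le_mul_of_nonneg_right ?_ (by positivity)
              linarith [tensorWeight_le l hd.le i₀]
          _ = _ := by ring
      · simp [topCoeff_eq_zero hφ hφ hd]
    · have : tensorWeight l α = normalWeight α := by
        push Not at h
        simp [tensorWeight, normalWeight, weight_eq, h]
      simp [this]
  refine (Finset.sum_le_sum fun α _ => h1 α).trans ?_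
  rw [← Finset.sum_filter, ← Finset.mul_sum]
  refine mul_le_mul_of_nonneg_left ?_ hρ
  refine (sum_weight_mul_le_sqrt_mul_sqrt _ _ _ _ fun α _ => normalWeight_nonneg α).trans ?_
  simp only [sq_abs]
  refine (mul_le_mul (Real.sqrt_le_sqrt (sum_normalWeight_mul_topCoeff_sq_le hφ))
    (Real.sqrt_le_sqrt (sum_normalWeight_mul_topCoeff_sq_le hψ)) (Real.sqrt_nonneg _)
    (Real.sqrt_nonneg _)).trans (le_of_eq ?_)
  rw [Real.sqrt_mul (Nat.cast_nonneg _), Real.sqrt_mul (Nat.cast_nonneg _), mul_mul_mul_comm,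
    Real.mul_self_sqrt (Nat.cast_nonneg _)]

/-! ### Homogeneous sums as multilinear polynomials -/

/-- The coefficient of the monomial `∏ i ∈ S, Y i` in the homogeneous sum with kernel `f`. -/
noncomputable def setCoeff (f : (Fin p → Fin N) → ℝ) (S : Finset (Fin N)) : ℝ :=
  ∑ j, if Finset.univ.image j = S then f j else 0

theorem injective_of_ne_zero {f : (Fin p → Fin N) → ℝ} (hf : VanishesOnDiagonals f)
    {j : Fin p → Fin N} (h : f j ≠ 0) : Function.Injective j := by
  by_contra hj
  exact h (hf j hj)

theorem isHomogeneous_setCoeff {f : (Fin p → Fin N) → ℝ} (hf : VanishesOnDiagonals f) :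
    IsHomogeneous p (setCoeff f) := by
  intro S hS
  obtain ⟨j, -, hj⟩ := Finset.exists_ne_zero_of_sum_ne_zero hS
  split_ifs at hj with h
  · rw [← h, Finset.card_image_of_injective _ (injective_of_ne_zero hf hj), Finset.card_fin]
  · exact absurd rfl hj

theorem Q_eq_multilin (l : Fin N → Law) {f : (Fin p → Fin N) → ℝ} (hf : VanishesOnDiagonals f) :
    Q l f = multilin l (setCoeff f) := by
  funext ω
  simp only [Q, homSum, multilin, setCoeff, Finset.sum_mul, ite_mul, zero_mul]
  rw [Finset.sum_comm]
  refine Finset.sum_congr rfl fun j _ => ?_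
  rw [Finset.sum_ite_eq, if_pos (Finset.mem_univ _)]
  by_cases h : f j = 0
  · simp [h]
  · rw [Finset.prod_image (injective_of_ne_zero hf h).injOn]

theorem card_injective_image_eq_le (S : Finset (Fin N)) :
    (Finset.univ.filter fun j : Fin p → Fin N =>
      Function.Injective j ∧ Finset.univ.image j = S).card ≤ p.factorial := by
  classical
  rcases Finset.eq_empty_or_nonempty (Finset.univ.filter fun j : Fin p → Fin N =>
      Function.Injective j ∧ Finset.univ.image j = S) with h | ⟨j₀, h⟩
  · rw [h]; simp
  rw [Finset.mem_filter] at h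
  refine (Finset.card_le_card (t := (Finset.univ : Finset (Equiv.Perm (Fin p))).image
    fun σ k => j₀ (σ k)) fun j hj => ?_).trans (Finset.card_image_le.trans (le_of_eq ?_))
  · rw [Finset.mem_filter] at hj
    have hex (k : Fin p) : ∃ m, j₀ m = j k := by
      have : j k ∈ Finset.univ.image j₀ := by
        rw [h.2.2, ← hj.2.2]; exact Finset.mem_image_of_mem _ (Finset.mem_univ _)
      simpa using this
    choose σ hσ using hex
    have hi : Function.Injective σ := fun a b hab => hj.2.1 (by rw [← hσ a, ← hσ b, hab])
    exact Finset.mem_image.2 ⟨Equiv.ofBijective σ (Finite.injective_iff_bijective.1 hi),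
      Finset.mem_univ _, funext hσ⟩
  · rw [Finset.card_univ, Fintype.card_perm, Fintype.card_fin]

theorem setCoeff_sq_le {f : (Fin p → Fin N) → ℝ} (hf : VanishesOnDiagonals f)
    (S : Finset (Fin N)) :
    setCoeff f S ^ 2 ≤ p.factorial * ∑ j, if Finset.univ.image j = S then f j ^ 2 else 0 := by
  classical
  have h : setCoeff f S = ∑ j with Function.Injective j ∧ Finset.univ.image j = S, f j := by
    rw [setCoeff, ← Finset.sum_filter]
    refine (Finset.sum_subset (fun j hj => ?_) fun j hj hj' => ?_).symm
    · simp only [Finset.mem_filter] at hj ⊢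
      exact ⟨hj.1, hj.2.2⟩
    · by_contra h0
      simp only [Finset.mem_filter] at hj hj'
      exact hj' ⟨hj.1, injective_of_ne_zero hf h0, hj.2⟩
  rw [h]
  refine sq_sum_le_card_mul_sum_sq.trans (mul_le_mul ?_ ?_
    (Finset.sum_nonneg fun _ _ => sq_nonneg _) (Nat.cast_nonneg _))
  · exact_mod_cast card_injective_image_eq_le S
  · rw [← Finset.sum_filter]
    refine Finset.sum_le_sum_of_subset_of_nonneg (fun j hj => ?_) fun _ _ _ => sq_nonneg _
    simp only [Finset.mem_filter] at hj ⊢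
    exact ⟨hj.1, hj.2.2⟩

theorem sum_setCoeff_sq_le [NeZero p] {f : (Fin p → Fin N) → ℝ} (hs : IsSymm f)
    (hf : VanishesOnDiagonals f) (i : Fin N) :
    ∑ S with i ∈ S, setCoeff f S ^ 2 ≤ p * p.factorial * influence f i := by
  -- By symmetry of `f`, every argument slot yields the same influence.
  have hk (k : Fin p) : (∑ j : Fin p → Fin N, if j k = i then f j ^ 2 else 0) = influence f i := by
    rw [influence, Finset.sum_filter,
      ← Equiv.sum_comp ((Equiv.swap 0 k).arrowCongr (Equiv.refl (Fin N)))]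
    refine Finset.sum_congr rfl fun j _ => ?_
    have h1 := hs (Equiv.swap 0 k) j
    have h2 : (Equiv.swap 0 k).arrowCongr (Equiv.refl (Fin N)) j =
        fun m => j (Equiv.swap 0 k m) := by
      funext m; simp [Equiv.arrowCongr]
    rw [h2, h1]
    simp only [Equiv.swap_apply_right]
  calc ∑ S with i ∈ S, setCoeff f S ^ 2
      ≤ ∑ S with i ∈ S, p.factorial * ∑ j, (if Finset.univ.image j = S then f j ^ 2 else 0) :=
        Finset.sum_le_sum fun S _ => setCoeff_sq_le hf S
    _ = p.factorial * ∑ j, if i ∈ Finset.univ.image j then f j ^ 2 else 0 := by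
        rw [← Finset.mul_sum, Finset.sum_comm]
        simp
    _ ≤ p.factorial * ∑ j : Fin p → Fin N, ∑ k, if j k = i then f j ^ 2 else 0 := by
        refine mul_le_mul_of_nonneg_left (Finset.sum_le_sum fun j _ => ?_) (Nat.cast_nonneg _)
        have hn (k : Fin p) : 0 ≤ if j k = i then f j ^ 2 else 0 := by split_ifs <;> positivity
        split_ifs with h
        · obtain ⟨k, -, hk⟩ := Finset.mem_image.1 h
          refine le_trans (le_of_eq ?_)
            (Finset.single_le_sum (fun k _ => hn k) (Finset.mem_univ k))
          rw [if_pos hk]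
        · exact Finset.sum_nonneg fun k _ => hn k
    _ = _ := by
        rw [Finset.sum_comm]
        simp only [hk, Finset.sum_const, Finset.card_fin, nsmul_eq_mul]
        ring

theorem sq_le_c (p : ℕ) [NeZero p] : p ^ 2 ≤ c p := by
  have h : 1 ∈ Finset.Icc 1 p := by simp [Nat.one_le_iff_ne_zero, NeZero.ne p]
  refine le_trans (le_of_eq ?_) (Finset.single_le_sum
    (f := fun r => r.factorial * p.choose r ^ 2) (fun _ _ => Nat.zero_le _) h)
  simp

/-- Each kernel costs `p * p!`, and `centralBinom p * p!² = (2p)!`. The remaining `p²` is the `r =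
1` term of `c p`. -/
theorem centralBinom_mul_sqrt_le [NeZero p] {f g : (Fin p → Fin N) → ℝ} (hf : IsSymm f)
    (hf0 : VanishesOnDiagonals f) (hg : IsSymm g) (hg0 : VanishesOnDiagonals g) :
    (Nat.centralBinom p : ℝ) * (√(∑ i, (∑ S with i ∈ S, setCoeff f S ^ 2) ^ 2) *
      √(∑ i, (∑ S with i ∈ S, setCoeff g S ^ 2) ^ 2)) ≤
      (2 * p).factorial * c p * (√(∑ i, influence f i ^ 2) * √(∑ i, influence g i ^ 2)) := by
  have h {f : (Fin p → Fin N) → ℝ} (hf : IsSymm f) (hf0 : VanishesOnDiagonals f) :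
      √(∑ i, (∑ S with i ∈ S, setCoeff f S ^ 2) ^ 2) ≤
        p * p.factorial * √(∑ i, influence f i ^ 2) := by
    have hp : (0 : ℝ) ≤ p * p.factorial := by positivity
    rw [← Real.sqrt_sq hp, ← Real.sqrt_mul (sq_nonneg _), Finset.mul_sum]
    refine Real.sqrt_le_sqrt (Finset.sum_le_sum fun i _ => ?_)
    rw [← mul_pow]
    exact pow_le_pow_left₀ (Finset.sum_nonneg fun _ _ => sq_nonneg _)
      (sum_setCoeff_sq_le hf hf0 i) 2
  have hfac : (Nat.centralBinom p : ℝ) * (p.factorial * p.factorial) = (2 * p).factorial := by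
    have := Nat.choose_mul_factorial_mul_factorial (n := 2 * p) (k := p) (by omega)
    rw [← Nat.centralBinom_eq_two_mul_choose, show 2 * p - p = p by omega] at this
    rw [← mul_assoc]
    exact_mod_cast this
  have hc : (p : ℝ) ^ 2 ≤ c p := by exact_mod_cast sq_le_c p
  calc _ ≤ (Nat.centralBinom p : ℝ) * ((p * p.factorial * √(∑ i, influence f i ^ 2)) *
        (p * p.factorial * √(∑ i, influence g i ^ 2))) := by
        refine mul_le_mul_of_nonneg_left ?_ (Nat.cast_nonneg _)
        exact mul_le_mul (h hf hf0) (h hg hg0) (Real.sqrt_nonneg _) (by positivity)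
    _ = (2 * p).factorial * (p : ℝ) ^ 2 *
        (√(∑ i, influence f i ^ 2) * √(∑ i, influence g i ^ 2)) := by rw [← hfac]; ring
    _ ≤ _ := by gcongr

/-! ### Moments of homogeneous multilinear polynomials -/

theorem tensorWeight_zero (l : Fin N → Law) : tensorWeight l 0 = 1 := by
  simp [tensorWeight, Law.weight]

theorem degree_zero : degree (0 : Fin N → Fin 3) = 0 := by simp [degree]

/-- The squared norm of the part of positive, non-maximal degree in the expansion of the square of a
multilinear polynomial. -/
noncomputable def lowerNorm (l : Fin N → Law) (φ : Finset (Fin N) → ℝ) : ℝ :=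
  ∑ α with α ≠ 0, tensorWeight l α * (prodCoeff l φ φ α - topCoeff φ φ α) ^ 2

theorem lowerNorm_nonneg (l : Fin N → Law) (φ : Finset (Fin N) → ℝ) : 0 ≤ lowerNorm l φ :=
  Finset.sum_nonneg fun α _ => mul_nonneg (tensorWeight_nonneg l α) (sq_nonneg _)

/-- Hence `prodCoeff - topCoeff` and `topCoeff` have disjoint supports, and squares and products
split without cross terms. -/
theorem prodCoeff_or (l : Fin N → Law) {φ ψ : Finset (Fin N) → ℝ} (hφ : IsHomogeneous p φ)
    (hψ : IsHomogeneous q ψ) (α : Fin N → Fin 3) :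
    (degree α < p + q ∧ topCoeff φ ψ α = 0) ∨
      (p + q ≤ degree α ∧ prodCoeff l φ ψ α = topCoeff φ ψ α) := by
  rcases lt_or_ge (degree α) (p + q) with h | h
  · exact .inl ⟨h, topCoeff_eq_zero hφ hψ h.ne⟩
  · exact .inr ⟨h, prodCoeff_eq_topCoeff l hφ hψ h⟩

theorem topCoeff_zero {φ ψ : Finset (Fin N) → ℝ} (hφ : IsHomogeneous p φ)
    (hψ : IsHomogeneous q ψ) (hq : q ≠ 0) : topCoeff φ ψ 0 = 0 :=
  topCoeff_eq_zero hφ hψ (by rw [degree_zero]; omega)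

theorem integral_multilin_pow_four (l : Fin N → Law) (φ : Finset (Fin N) → ℝ) :
    ∫ ω, multilin l φ ω ^ 4 ∂(prob l) = ∑ α, tensorWeight l α * prodCoeff l φ φ α ^ 2 := by
  have h (ω) : multilin l φ ω ^ 4 =
      expansion l (prodCoeff l φ φ) ω * expansion l (prodCoeff l φ φ) ω := by
    rw [← multilin_mul]; ring
  simp_rw [h, integral_expansion_mul]
  exact Finset.sum_congr rfl fun α _ => by ring

theorem memLp_multilin (l : Fin N → Law) (φ : Finset (Fin N) → ℝ) :
    MemLp (multilin l φ) 4 (prob l) := by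
  have hm : AEStronglyMeasurable (multilin l φ) (prob l) := by
    rw [multilin_eq_expansion]; exact (memLp_expansion l _).aestronglyMeasurable
  have h := (memLp_expansion l (prodCoeff l φ φ)).integrable_sq
  rw [← integrable_norm_rpow_iff hm (by simp) (by simp)]
  refine h.congr (.of_forall fun ω => ?_)
  have h4 : ‖multilin l φ ω‖ ^ (ENNReal.toReal 4) = ‖multilin l φ ω‖ ^ (4 : ℕ) := by
    rw [← Real.rpow_natCast]; simp
  simp only [← multilin_mul]
  rw [h4, Real.norm_eq_abs, ← abs_pow, abs_of_nonneg (by positivity)]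
  ring

theorem integral_multilin (l : Fin N → Law) {φ : Finset (Fin N) → ℝ} (hφ : IsHomogeneous p φ)
    (hp : p ≠ 0) : ∫ ω, multilin l φ ω ∂(prob l) = 0 := by
  rw [multilin_eq_expansion, integral_expansion]
  refine Finset.sum_eq_zero fun S _ => ?_
  split_ifs with h
  · by_contra h0
    have := degree_indicatorAdd S ∅
    rw [h, degree_zero, hφ S h0] at this
    simp at this
    exact hp this.symm
  · rfl

theorem kappa4_multilin (l : Fin N → Law) {φ : Finset (Fin N) → ℝ} (hφ : IsHomogeneous p φ)
    (hp : p ≠ 0) : kappa4 (multilin l φ) (prob l) =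
      ∑ α, tensorWeight l α * prodCoeff l φ φ α ^ 2 - 3 * (∑ S, φ S ^ 2) ^ 2 := by
  have h2 : ∫ ω, multilin l φ ω ^ 2 ∂(prob l) = ∑ S, φ S ^ 2 := by
    simp only [pow_two, multilin_mul]
    rw [integral_expansion, prodCoeff_zero]
  simp only [kappa4, centralMoment, integral_multilin l hφ hp, Pi.pow_apply, Pi.sub_apply,
    sub_zero, h2, integral_multilin_pow_four]

theorem sum_ne_zero_eq (l : Fin N → Law) (h : (Fin N → Fin 3) → ℝ) :
    ∑ α with α ≠ 0, tensorWeight l α * h α = ∑ α, tensorWeight l α * h α - h 0 := by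
  rw [Finset.filter_ne', Finset.sum_erase_eq_sub (Finset.mem_univ _), tensorWeight_zero, one_mul]

/-- Of the `3 E[F²]²` subtracted in `κ₄`, one copy cancels the constant term of `F²`, and
`topCoeff_self_ge` supplies the other two. -/
theorem lowerNorm_le_kappa4 (l : Fin N → Law) {φ : Finset (Fin N) → ℝ} (hφ : IsHomogeneous p φ)
    (hp : p ≠ 0) : lowerNorm l φ ≤ kappa4 (multilin l φ) (prob l) := by
  have h (α) : (prodCoeff l φ φ α - topCoeff φ φ α) ^ 2 =
      prodCoeff l φ φ α ^ 2 - topCoeff φ φ α ^ 2 := by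
    rcases prodCoeff_or l hφ hφ α with ⟨-, h⟩ | ⟨-, h⟩ <;> rw [h] <;> ring
  have ht : ∑ α, normalWeight α * topCoeff φ φ α ^ 2 ≤ ∑ α, tensorWeight l α * topCoeff φ φ α ^ 2 :=
    Finset.sum_le_sum fun α _ =>
      mul_le_mul_of_nonneg_right (normalWeight_le_tensorWeight l α) (sq_nonneg _)
  have h0 : prodCoeff l φ φ 0 = ∑ S, φ S ^ 2 := by simp only [prodCoeff_zero, pow_two]
  have hs := topCoeff_self_ge hφ hp
  rw [kappa4_multilin l hφ hp, lowerNorm]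
  simp only [h]
  rw [sum_ne_zero_eq, topCoeff_zero hφ hφ hp, h0]
  simp only [mul_sub, Finset.sum_sub_distrib]
  linarith

/-! ### Variance bounds for the carré du champ -/

theorem variance_carreDuChamp_le (l : Fin N → Law) {φ ψ : Finset (Fin N) → ℝ}
    (hφ : IsHomogeneous p φ) (hψ : IsHomogeneous q ψ) (hpq : p ≤ q) (hq : q ≠ 0) :
    variance (fun ω => (1 / (q : ℝ)) * carreDuChamp l (multilin l φ) (multilin l ψ) ω) (prob l) ≤
      ∑ α, tensorWeight l α * (prodCoeff l φ φ α * prodCoeff l ψ ψ α) - (∑ S, φ S * ψ S) ^ 2 -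
        ∑ α, tensorWeight l α * topCoeff φ ψ α ^ 2 := by
  have hq' : (0 : ℝ) < q := by exact_mod_cast Nat.pos_of_ne_zero hq
  have he : (fun ω => (1 / (q : ℝ)) * carreDuChamp l (multilin l φ) (multilin l ψ) ω) =
      expansion l (fun α => (((p : ℝ) + q - degree α) / (2 * q)) * prodCoeff l φ ψ α) := by
    funext ω
    rw [carreDuChamp_multilin l hφ hψ, expansion, expansion, Finset.mul_sum]
    refine Finset.sum_congr rfl fun α _ => ?_
    field_simp
  -- Parseval applied to `E[F²G²]` in two ways: as `⟨F², G²⟩` and as `‖FG‖²`.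
  have hE : ∑ α, tensorWeight l α * (prodCoeff l φ φ α * prodCoeff l ψ ψ α) =
      ∑ α, tensorWeight l α * prodCoeff l φ ψ α ^ 2 := by
    have h1 := integral_expansion_mul l (prodCoeff l φ φ) (prodCoeff l ψ ψ)
    have h2 := integral_expansion_mul l (prodCoeff l φ ψ) (prodCoeff l φ ψ)
    simp only [← multilin_mul] at h1 h2
    have h3 : ∫ ω, multilin l φ ω * multilin l φ ω * (multilin l ψ ω * multilin l ψ ω) ∂(prob l) =
        ∫ ω, multilin l φ ω * multilin l ψ ω * (multilin l φ ω * multilin l ψ ω) ∂(prob l) := by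
      congr 1; ext ω; ring
    rw [h1, h2] at h3
    simpa only [pow_two, mul_comm (tensorWeight l _)] using h3
  have ht : (∑ S, φ S * ψ S) ^ 2 = prodCoeff l φ ψ 0 ^ 2 - topCoeff φ ψ 0 ^ 2 := by
    rw [prodCoeff_zero, topCoeff_zero hφ hψ hq]; ring
  rw [he, variance_expansion, hE, ht]
  have := sum_ne_zero_eq l fun α => prodCoeff l φ ψ α ^ 2 - topCoeff φ ψ α ^ 2
  simp only [mul_sub, Finset.sum_sub_distrib] at this
  refine le_trans (Finset.sum_le_sum (g := fun α => tensorWeight l α * prodCoeff l φ ψ α ^ 2 -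
    tensorWeight l α * topCoeff φ ψ α ^ 2) fun α _ => ?_) (le_of_eq ?_)
  · rcases prodCoeff_or l hφ hψ α with ⟨hd, h⟩ | ⟨hd, h⟩
    · rw [h]
      have hd' : (degree α : ℝ) < p + q := by exact_mod_cast hd
      have hpq' : (p : ℝ) ≤ q := by exact_mod_cast hpq
      -- This is where `p ≤ q` enters: `p + q - |α| ≤ 2q`.
      have hk : (((p : ℝ) + q - degree α) / (2 * q)) ^ 2 ≤ 1 := by
        refine pow_le_one₀ (div_nonneg (by linarith) (by positivity)) ?_
        rw [div_le_one (by positivity)]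
        have : (0 : ℝ) ≤ degree α := Nat.cast_nonneg _
        linarith
      have := mul_le_mul_of_nonneg_right hk
        (mul_nonneg (tensorWeight_nonneg l α) (sq_nonneg (prodCoeff l φ ψ α)))
      calc _ = (((p : ℝ) + q - degree α) / (2 * q)) ^ 2 *
            (tensorWeight l α * prodCoeff l φ ψ α ^ 2) := by ring
        _ ≤ _ := by linarith
    · rw [h]
      by_cases he : degree α = p + q
      · rw [he]; simp
      · rw [topCoeff_eq_zero hφ hψ he]; simp
  · rw [Finset.sum_sub_distrib]
    linarith

theorem variance_carreDuChamp_le_of_lt (l : Fin N → Law) {φ ψ : Finset (Fin N) → ℝ}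
    (hφ : IsHomogeneous p φ) (hψ : IsHomogeneous q ψ) (hpq : p < q) :
    variance (fun ω => (1 / (q : ℝ)) * carreDuChamp l (multilin l φ) (multilin l ψ) ω) (prob l) ≤
      √(∫ ω, multilin l φ ω ^ 4 ∂(prob l)) * √(kappa4 (multilin l ψ) (prob l)) := by
  have hq : q ≠ 0 := by omega
  have hv := variance_carreDuChamp_le l hφ hψ hpq.le hq
  have h1 : (∑ S, φ S ^ 2) * ∑ S, ψ S ^ 2 ≤ ∑ α, tensorWeight l α * topCoeff φ ψ α ^ 2 :=
    (topCoeff_ge_of_lt hφ).trans (Finset.sum_le_sum fun α _ =>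
      mul_le_mul_of_nonneg_right (normalWeight_le_tensorWeight l α) (sq_nonneg _))
  have h2 := sum_ne_zero_eq l fun α => prodCoeff l φ φ α * prodCoeff l ψ ψ α
  simp only [prodCoeff_zero] at h2
  -- In degrees at least `2q > 2p` the coefficients of `F²` vanish, so only the part of `G²` below
  -- its top degree is seen.
  have h3 : ∑ α with α ≠ 0, tensorWeight l α * (prodCoeff l φ φ α * prodCoeff l ψ ψ α) =
      ∑ α with α ≠ 0, tensorWeight l α *
        (prodCoeff l φ φ α * (prodCoeff l ψ ψ α - topCoeff ψ ψ α)) := by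
    refine Finset.sum_congr rfl fun α _ => ?_
    rcases prodCoeff_or l hψ hψ α with ⟨-, h⟩ | ⟨hd, -⟩
    · rw [h, sub_zero]
    · rw [prodCoeff_eq_topCoeff l hφ hφ (by omega), topCoeff_eq_zero hφ hφ (by omega)]
      simp
  have h4 := sum_weight_mul_le_sqrt_mul_sqrt (Finset.univ.filter fun α : Fin N → Fin 3 => α ≠ 0)
    (tensorWeight l) (prodCoeff l φ φ) (fun α => prodCoeff l ψ ψ α - topCoeff ψ ψ α)
    fun α _ => tensorWeight_nonneg l α
  have h5 : √(∑ α with α ≠ 0, tensorWeight l α * prodCoeff l φ φ α ^ 2) ≤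
      √(∫ ω, multilin l φ ω ^ 4 ∂(prob l)) := by
    rw [integral_multilin_pow_four]
    exact Real.sqrt_le_sqrt (Finset.sum_le_sum_of_subset_of_nonneg (Finset.filter_subset _ _)
      fun α _ _ => mul_nonneg (tensorWeight_nonneg l α) (sq_nonneg _))
  have h6 := h4.trans (mul_le_mul h5 (Real.sqrt_le_sqrt (lowerNorm_le_kappa4 l hψ hq))
    (Real.sqrt_nonneg _) (Real.sqrt_nonneg _))
  simp only [← pow_two] at h2
  nlinarith [sq_nonneg (∑ S, φ S * ψ S)]

theorem variance_carreDuChamp_le_of_eq (l : Fin N → Law) {φ ψ : Finset (Fin N) → ℝ}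
    (hφ : IsHomogeneous p φ) (hψ : IsHomogeneous p ψ) (hp : p ≠ 0) :
    variance (fun ω => (1 / (p : ℝ)) * carreDuChamp l (multilin l φ) (multilin l ψ) ω) (prob l) ≤
      √(kappa4 (multilin l φ) (prob l)) * √(kappa4 (multilin l ψ) (prob l)) +
      ∑ α, (tensorWeight l α - normalWeight α) * (topCoeff φ φ α * topCoeff ψ ψ α) := by
  have hv := variance_carreDuChamp_le l hφ hψ le_rfl hp
  have h1 : ∑ α, normalWeight α * topCoeff φ ψ α ^ 2 ≤ ∑ α, tensorWeight l α * topCoeff φ ψ α ^ 2 :=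
    Finset.sum_le_sum fun α _ =>
      mul_le_mul_of_nonneg_right (normalWeight_le_tensorWeight l α) (sq_nonneg _)
  have h2 := topCoeff_cross_le hφ hψ
  have h3 := sum_ne_zero_eq l fun α =>
    prodCoeff l φ φ α * prodCoeff l ψ ψ α - topCoeff φ φ α * topCoeff ψ ψ α
  have h4 := sum_weight_mul_le_sqrt_mul_sqrt (Finset.univ.filter fun α : Fin N → Fin 3 => α ≠ 0)
    (tensorWeight l) (fun α => prodCoeff l φ φ α - topCoeff φ φ α)
    (fun α => prodCoeff l ψ ψ α - topCoeff ψ ψ α) fun α _ => tensorWeight_nonneg l α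
  have h5 := h4.trans (mul_le_mul (Real.sqrt_le_sqrt (lowerNorm_le_kappa4 l hφ hp))
    (Real.sqrt_le_sqrt (lowerNorm_le_kappa4 l hψ hp)) (Real.sqrt_nonneg _) (Real.sqrt_nonneg _))
  -- For `p = q` both squares have the same top degree, so their lower and top parts pair
  -- separately.
  have h6 (α) : prodCoeff l φ φ α * prodCoeff l ψ ψ α - topCoeff φ φ α * topCoeff ψ ψ α =
      (prodCoeff l φ φ α - topCoeff φ φ α) * (prodCoeff l ψ ψ α - topCoeff ψ ψ α) := by
    rcases prodCoeff_or l hφ hφ α with ⟨hd, h⟩ | ⟨hd, h⟩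
    · rw [h, topCoeff_eq_zero hψ hψ hd.ne]; ring
    · rw [h, prodCoeff_eq_topCoeff l hψ hψ hd]; ring
  simp only [← h6] at h5
  rw [h3] at h5
  simp only [mul_sub, Finset.sum_sub_distrib, prodCoeff_zero, topCoeff_zero hφ hφ hp, zero_mul,
    sub_zero, ← pow_two] at h5
  simp only [sub_mul, Finset.sum_sub_distrib]
  linarith

end NormalGamma

theorem mainTheorem10 {N : ℕ} (l : Fin N → NormalGamma.Law) (p q : ℕ) [NeZero p] [NeZero q]
    (hpq : p ≤ q) (f : (Fin p → Fin N) → ℝ) (g : (Fin q → Fin N) → ℝ)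
    (hf : NormalGamma.IsSymm f) (hf0 : NormalGamma.VanishesOnDiagonals f)
    (hg : NormalGamma.IsSymm g) (hg0 : NormalGamma.VanishesOnDiagonals g) :
    MemLp (NormalGamma.Q l f) 4 (NormalGamma.prob l) ∧
    MemLp (NormalGamma.Q l g) 4 (NormalGamma.prob l) ∧
    MemLp (NormalGamma.carreDuChamp l (NormalGamma.Q l f) (NormalGamma.Q l g)) 2
      (NormalGamma.prob l) ∧
    0 ≤ NormalGamma.kappa4 (NormalGamma.Q l f) (NormalGamma.prob l) ∧
    0 ≤ NormalGamma.kappa4 (NormalGamma.Q l g) (NormalGamma.prob l) ∧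
    variance
        (fun ω => (1 / (q : ℝ)) *
          NormalGamma.carreDuChamp l (NormalGamma.Q l f) (NormalGamma.Q l g) ω)
        (NormalGamma.prob l) ≤
      (if p < q then
        √(∫ ω, NormalGamma.Q l f ω ^ 4 ∂(NormalGamma.prob l)) *
          √(NormalGamma.kappa4 (NormalGamma.Q l g) (NormalGamma.prob l))
      else 0) +
      (if p = q then
        2 * √(NormalGamma.kappa4 (NormalGamma.Q l f) (NormalGamma.prob l)) *
            √(NormalGamma.kappa4 (NormalGamma.Q l g) (NormalGamma.prob l)) +
          (((2 : ℝ) ^ p)⁻¹ * NormalGamma.vMax l ^ p - 1) * ((2 * p).factorial : ℝ) *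
            (NormalGamma.c p : ℝ) * √(∑ i, NormalGamma.influence f i ^ 2) *
            √(∑ i, NormalGamma.influence g i ^ 2)
      else 0) := by
  have hφ := NormalGamma.isHomogeneous_setCoeff hf0
  have hψ := NormalGamma.isHomogeneous_setCoeff hg0
  have hp : p ≠ 0 := NeZero.ne p
  have hq : q ≠ 0 := NeZero.ne q
  rw [NormalGamma.Q_eq_multilin l hf0, NormalGamma.Q_eq_multilin l hg0]
  refine ⟨NormalGamma.memLp_multilin l _, NormalGamma.memLp_multilin l _, ?_,
    (NormalGamma.lowerNorm_nonneg l _).trans (NormalGamma.lowerNorm_le_kappa4 l hφ hp),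
    (NormalGamma.lowerNorm_nonneg l _).trans (NormalGamma.lowerNorm_le_kappa4 l hψ hq), ?_⟩
  · rw [NormalGamma.carreDuChamp_multilin l hφ hψ]
    exact NormalGamma.memLp_expansion l _
  rcases hpq.lt_or_eq with h | rfl
  · rw [if_pos h, if_neg h.ne, add_zero]
    exact NormalGamma.variance_carreDuChamp_le_of_lt l hφ hψ h
  · rw [if_neg (lt_irrefl p), if_pos rfl, zero_add]
    refine (NormalGamma.variance_carreDuChamp_le_of_eq l hφ hψ hp).trans (add_le_add ?_ ?_)
    -- The argument yields the factor `1` in front of the cumulants; the stated `2` is weaker.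
    · rw [mul_assoc]
      exact le_mul_of_one_le_left (by positivity) one_le_two
    -- For `N = 0` the supremum `vMax` is `0`, so the factor `(vMax / 2) ^ p - 1` is negative. The
    -- weights then coincide and the influence sums are empty, so both sides vanish.
    rcases isEmpty_or_nonempty (Fin N) with hN | ⟨⟨i₀⟩⟩
    · have h0 : ∀ α : Fin N → Fin 3, NormalGamma.tensorWeight l α =
          NormalGamma.normalWeight α := fun α => by
        simp [NormalGamma.tensorWeight, NormalGamma.normalWeight]
      simp [h0]
    · refine (NormalGamma.sum_weight_excess_le l hφ hψ i₀).trans ?_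
      have hv : 1 ≤ NormalGamma.vMax l / 2 := by
        linarith [NormalGamma.v_le_vMax l i₀, (l i₀).two_le_v]
      have hρ : 0 ≤ (NormalGamma.vMax l / 2) ^ p - 1 := by linarith [one_le_pow₀ hv (n := p)]
      refine (mul_le_mul_of_nonneg_left
        (NormalGamma.centralBinom_mul_sqrt_le hf hf0 hg hg0) hρ).trans (le_of_eq ?_)
      rw [div_pow]
      ring
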